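/- Fix integers $m\ge 2$ and $\ell\ge 2$. For $n\ge 1$ let $G^m_n$ be the uniform attachment graph: the random multigraph on the vertex set $[n]=\{1,\dots,n\}$ in which every vertex $j\in\{2,\dots,n\}$ has $m$ edges labelled $1,\dots,m$ to vertices with smaller number, the other endpoint of each of these edges being chosen uniformly at random from $[j-1]=\{1,\dots,j-1\}$, all choices being independent (so multiple edges are allowed). Let $W_n$ be the number of $\ell$-cycles in $G^m_n$, that is, the number of subgraphs of the multigraph $G^m_n$ that are cycles with $\ell$ vertices and $\ell$ edges; a pair of parallel edges is a $2$-cycle, and subgraphs with different edge sets are counted separately. Let $\mu_n:=\mathbb{E}W_n$. Then $$\mu_n=\Theta(\log n)\qquad\text{as } n\to\infty,$$ and there is a positive constant $C=C(m,\ell)$ such that for all $n\ge 2$ $$d_{\mathrm{TV}}\bigl(\mathcal{L}(W_n),\mathrm{Po}(\mu_n)\bigr)\le \frac{C}{\log n},$$ where $\mathcal{L}(W_n)$ is the law of $W_n$, $\mathrm{Po}(\mu)$ is the Poisson distribution with mean $\mu$ (the point mass at $0$ if $\mu=0$), and $d_{\mathrm{TV}}(\nu_1,\nu_2)=\sup_{A\subseteq\{0,1,2,\dots\}}|\nu_1(A)-\nu_2(A)|$.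 -/

import Mathlib

open MeasureTheory ProbabilityTheory Filter Asymptotics

namespace UniformAttachment

/-- The `m`-fold complete multigraph on `[n] = {1, …, n}`: for `1 ≤ i < j ≤ n` and every label
`a : Fin m` there is one edge `(j, i, a)`, and it joins `j` and `i`. -/
def completeMultigraph (m n : ℕ) : Graph ℕ (ℕ × ℕ × Fin m) where
  vertexSet := Set.Icc 1 n
  IsLink e x y := (1 ≤ e.2.1 ∧ e.2.1 < e.1 ∧ e.1 ≤ n) ∧
    ((x = e.1 ∧ y = e.2.1) ∨ (x = e.2.1 ∧ y = e.1))
  isLink_symm := fun _ _ => ⟨fun _ _ h => ⟨h.1, h.2.symm.imp And.symm And.symm⟩⟩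
  eq_or_eq_of_isLink_of_isLink := by
    rintro ⟨j, i, a⟩ x y v w ⟨-, h⟩ ⟨-, h'⟩
    simp only at h h'
    omega
  left_mem_of_isLink := by
    rintro ⟨j, i, a⟩ x y ⟨h, h'⟩
    simp only at h h'
    simp only [Set.mem_Icc]
    omega

/-- The sample space: for each vertex `j ∈ {2, …, n}` and each label `a`, the endpoint in
`[j - 1] = {1, …, j - 1}` of the `a`-th edge of `j`. -/
abbrev Choices (m n : ℕ) : Type :=
  (s : Finset.Icc 2 n × Fin m) → Finset.Ico 1 (s.1 : ℕ)

instance nonempty_Ico {n : ℕ} (j : Finset.Icc 2 n) : Nonempty (Finset.Ico 1 (j : ℕ)) :=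
  ⟨⟨1, Finset.mem_Ico.2 ⟨le_rfl, (Finset.mem_Icc.1 j.2).1⟩⟩⟩

/-- All endpoints are chosen independently, the one of an edge of `j` uniformly on `[j - 1]`. -/
noncomputable def choiceMeasure (m n : ℕ) : Measure (Choices m n) :=
  Measure.pi fun s => uniformOn (Set.univ : Set (Finset.Ico 1 (s.1 : ℕ)))

instance (m n : ℕ) : IsProbabilityMeasure (choiceMeasure m n) := by
  unfold choiceMeasure; infer_instance

/-- The uniform attachment graph `G^m_n` given by the choices `ω`: the spanning subgraph of the
`m`-fold complete multigraph whose edges are the chosen ones. -/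
def attachmentGraph {m n : ℕ} (ω : Choices m n) : Graph ℕ (ℕ × ℕ × Fin m) :=
  (completeMultigraph m n).restrict
    (Set.range fun s : Finset.Icc 2 n × Fin m => ((s.1 : ℕ), (ω s : ℕ), s.2))

/-- The multigraph `H` is an `ℓ`-cycle (`ℓ ≥ 2`): it consists of `ℓ` distinct vertices `v i` and
`ℓ` distinct edges `e i`, indexed cyclically, with `e i` joining `v i` and `v (i + 1)`.
For `ℓ = 2` this is a pair of parallel edges. -/
def IsCycleGraph {α β : Type*} (ℓ : ℕ) (H : Graph α β) : Prop :=
  ∃ (v : ZMod ℓ → α) (e : ZMod ℓ → β), Function.Injective v ∧ Function.Injective e ∧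
    H.vertexSet = Set.range v ∧ H.edgeSet = Set.range e ∧ ∀ i, H.IsLink (e i) (v i) (v (i + 1))

/-- `W_n`, the number of subgraphs of `G^m_n` that are `ℓ`-cycles. -/
noncomputable def cycleCount (m ℓ n : ℕ) (ω : Choices m n) : ℕ :=
  {H : Graph ℕ (ℕ × ℕ × Fin m) | H ≤ attachmentGraph ω ∧ IsCycleGraph ℓ H}.ncard

theorem measurable_cycleCount (m ℓ n : ℕ) : Measurable (cycleCount m ℓ n) :=
  Measurable.of_discrete

/-- The law of `W_n`. -/
noncomputable def cycleLaw (m ℓ n : ℕ) : Measure ℕ :=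
  (choiceMeasure m n).map (cycleCount m ℓ n)

/-- `μ_n = E W_n`. -/
noncomputable def cycleMean (m ℓ n : ℕ) : ℝ :=
  ∫ ω, (cycleCount m ℓ n ω : ℝ) ∂(choiceMeasure m n)

/-- Since the sample space is finite, the expectation `μ_n` is that of an integrable variable. -/
theorem integrable_cycleCount (m ℓ n : ℕ) :
    Integrable (fun ω => (cycleCount m ℓ n ω : ℝ)) (choiceMeasure m n) :=
  Integrable.of_finite

theorem cycleMean_nonneg (m ℓ n : ℕ) : 0 ≤ cycleMean m ℓ n :=
  integral_nonneg fun _ => Nat.cast_nonneg _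

/-- Total variation distance of probability measures on `ℕ`: the supremum over all sets `A` of
`|ν₁ A - ν₂ A|` (every subset of `ℕ` is measurable). -/
noncomputable def tvDist (ν₁ ν₂ : Measure ℕ) : ℝ :=
  ⨆ A : Set ℕ, |ν₁.real A - ν₂.real A|

end UniformAttachment

/-! Write `W_n` as a sum of indicators over the `ℓ`-cycles `E` of the complete multigraph, with `ℓ =
r + 1`. An edge of `j` depends only on the choice at its slot (upper endpoint `j`, label), and slots
are independent. So the indicator of `E` is independent of all cycles that use none of its slots,
and the Stein–Chen method (`abs_real_sub_poisson_real_le`) bounds the distance to `Po(μ_n)` by `1 /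
μ_n` times the sum, over pairs of cycles with a common slot, of the products of their probabilities
and, for distinct cycles, of their joint probabilities. It remains to show that this sum is bounded
(`dependency_sum_le`) and that `μ_n` has order `log n`.

Both upper bounds come from one estimate: the cycles through a vertex `x` have total weight
`O(1/x)`. Up to a factor, a cycle weighs the product of `1 / max u v` over its edges, so this is a
sum over closed walks, controlled by a Schur test: `1/√v` is, up to a constant, a supersolution for
the kernel `1 / max u v` (`sum_inv_max_mul_inv_sqrt_le`, `sum_closed_walk_le`). Summing `1/x` over
`x ≤ n` gives `μ_n = O(log n)`. For pairs, edges of `F` already in `E` cost nothing; given `E`, the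
partners `F` have total weight `O(∑ 1/x)` over the vertices `x` of `E`, and summing over `E` leaves
the convergent series `∑ 1/x²`.

The lower bound on `μ_n` counts only cycles that visit their vertices in increasing order and then
return: about `k^r` of them have top vertex `k + 1`, each of probability at least `k^(-(r+1))`,
which gives a harmonic sum. -/

namespace UniformAttachment

open scoped NNReal

/-! ### The Stein equation of the Poisson law and the increments of its solution. -/

section Stein

theorem poisson_real_singleton_succ (r : ℝ≥0) (k : ℕ) :
    ((k : ℝ) + 1) * (poissonMeasure r).real {k + 1} = r * (poissonMeasure r).real {k} := by
  rw [poissonMeasure_real_singleton, poissonMeasure_real_singleton, Nat.factorial_succ]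
  have : (k.factorial : ℝ) ≠ 0 := by positivity
  push_cast
  field_simp
  ring

theorem poisson_hasSum_real (r : ℝ≥0) (A : Set ℕ) :
    HasSum (A.indicator fun k => (poissonMeasure r).real {k}) ((poissonMeasure r).real A) := by
  have h := hasSum_integral_poissonMeasure (r := r) (f := A.indicator fun _ => (1 : ℝ))
    ((integrable_const 1).indicator (MeasurableSet.of_discrete))
  rw [integral_indicator MeasurableSet.of_discrete] at h
  simp only [integral_const, MeasurableSet.univ, measureReal_restrict_apply, Set.univ_inter,
    smul_eq_mul, mul_one] at h
  convert! h using 1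
  ext k
  by_cases hk : k ∈ A <;> simp [hk, poissonMeasure_real_singleton]

theorem poisson_real_inter_Iic_succ (r : ℝ≥0) (A : Set ℕ) (k : ℕ) :
    (poissonMeasure r).real (A ∩ Set.Iic (k + 1)) = (poissonMeasure r).real (A ∩ Set.Iic k) +
      A.indicator (fun _ => 1) (k + 1) * (poissonMeasure r).real {k + 1} := by
  by_cases hk : k + 1 ∈ A
  · have : A ∩ Set.Iic (k + 1) = (A ∩ Set.Iic k) ∪ {k + 1} := by
      ext x
      simp only [Set.mem_inter_iff, Set.mem_Iic, Set.mem_union, Set.mem_singleton_iff]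
      constructor
      · rintro ⟨h1, h2⟩
        rcases Nat.le_succ_iff.1 h2 with h | h
        · exact Or.inl ⟨h1, h⟩
        · exact Or.inr h
      · rintro (⟨h1, h2⟩ | rfl)
        · exact ⟨h1, h2.trans (Nat.le_succ k)⟩
        · exact ⟨hk, le_rfl⟩
    rw [this, measureReal_union _ MeasurableSet.of_discrete]
    · simp [hk]
    · rw [Set.disjoint_singleton_right]
      simp
  · have : A ∩ Set.Iic (k + 1) = A ∩ Set.Iic k := by
      ext x
      simp only [Set.mem_inter_iff, Set.mem_Iic, and_congr_right_iff]
      intro h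
      have : x ≠ k + 1 := fun e => hk (e ▸ h)
      omega
    rw [this]
    simp [hk]

/-- Shift the tail by one and compare termwise: `r * P {i} = (i + 1) * P {i + 1}`, and `i + 1 ≥ k +
1` on the tail. This and `poisson_real_Iic_le` fix the signs in `steinSolution_diff_le`. -/
theorem poisson_real_Ioi_succ_le (r : ℝ≥0) (k : ℕ) :
    ((k : ℝ) + 1) * (poissonMeasure r).real (Set.Ioi (k + 1)) ≤
      r * (poissonMeasure r).real (Set.Ioi k) := by
  have h1 := (poisson_hasSum_real r (Set.Ioi (k + 1))).mul_left ((k : ℝ) + 1)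
  have h2 := (poisson_hasSum_real r (Set.Ioi k)).mul_left (r : ℝ)
  rw [← hasSum_nat_add_iff' 1] at h1
  simp only [Finset.range_one, Finset.sum_singleton] at h1
  have h0 : (0 : ℕ) ∉ Set.Ioi (k + 1) := by simp
  rw [Set.indicator_of_notMem h0, mul_zero, sub_zero] at h1
  refine hasSum_le (fun i => ?_) h1 h2
  by_cases hi : k < i
  · rw [Set.indicator_of_mem (by simpa using hi), Set.indicator_of_mem (by simpa using hi),
      ← poisson_real_singleton_succ]
    gcongr
  · rw [Set.indicator_of_notMem (by simpa using hi), Set.indicator_of_notMem (by simpa using hi)]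
    simp

theorem poisson_real_Iic_le (r : ℝ≥0) (k : ℕ) :
    r * (poissonMeasure r).real (Set.Iic k) ≤
      ((k : ℝ) + 1) * (poissonMeasure r).real (Set.Iic (k + 1)) := by
  have hs : ∀ k : ℕ, (poissonMeasure r).real (Set.Iic (k + 1)) =
      (poissonMeasure r).real (Set.Iic k) + (poissonMeasure r).real {k + 1} := by
    intro k
    simpa using poisson_real_inter_Iic_succ r Set.univ k
  induction k with
  | zero =>
    have h0 : Set.Iic (0 : ℕ) = {0} := by ext; simp
    have := poisson_real_singleton_succ r 0
    rw [hs, h0]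
    have h3 : 0 ≤ (poissonMeasure r).real {0} := measureReal_nonneg
    norm_num at this ⊢
    linarith
  | succ k ih =>
    have h1 := poisson_real_singleton_succ r (k + 1)
    have h2 := poisson_real_singleton_succ r k
    rw [hs (k + 1), mul_add, hs k, mul_add]
    have h3 : 0 ≤ (poissonMeasure r).real (Set.Iic (k + 1)) := measureReal_nonneg
    rw [hs k] at ih h3
    push_cast at *
    nlinarith

/-- The solution of the Stein equation of the Poisson distribution for the test set `A`. -/
noncomputable def steinSolution (r : ℝ≥0) (A : Set ℕ) : ℕ → ℝ
  -- The value at `0` is immaterial: in the Stein equation it is multiplied by `k = 0`.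
  | 0 => 0
  | k + 1 => ((poissonMeasure r).real (A ∩ Set.Iic k) -
      (poissonMeasure r).real A * (poissonMeasure r).real (Set.Iic k)) /
        (r * (poissonMeasure r).real {k})

theorem steinSolution_equation (r : ℝ≥0) (hr : 0 < r) (A : Set ℕ) (k : ℕ) :
    r * steinSolution r A (k + 1) - k * steinSolution r A k =
      A.indicator (fun _ => 1) k - (poissonMeasure r).real A := by
  have hp : ∀ k, 0 < (poissonMeasure r).real {k} := fun k =>
    poissonMeasure_real_singleton_pos k hr
  have hr' : (0 : ℝ) < r := hr
  cases k with
  | zero =>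
    have h0 : Set.Iic (0 : ℕ) = {0} := by ext; simp
    have hA : (poissonMeasure r).real (A ∩ Set.Iic 0) =
        A.indicator (fun _ => 1) 0 * (poissonMeasure r).real {0} := by
      rw [h0]
      by_cases h : 0 ∈ A <;> simp [h]
    have := hp 0
    simp only [steinSolution]
    rw [hA, h0]
    field_simp
    simp
  | succ k =>
    have h1 := poisson_real_inter_Iic_succ r A k
    have h2 := poisson_real_inter_Iic_succ r Set.univ k
    simp only [Set.univ_inter, Set.mem_univ, Set.indicator_of_mem, one_mul] at h2
    have h3 := poisson_real_singleton_succ r k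
    have hp1 := hp k
    have hp2 := hp (k + 1)
    simp only [steinSolution]
    rw [← h3, h1, h2]
    push_cast
    field_simp
    ring

theorem steinSolution_compl (r : ℝ≥0) (A : Set ℕ) (k : ℕ) :
    steinSolution r Aᶜ k = - steinSolution r A k := by
  cases k with
  | zero => simp [steinSolution]
  | succ k =>
    have h1 : (poissonMeasure r).real (Aᶜ ∩ Set.Iic k) =
        (poissonMeasure r).real (Set.Iic k) - (poissonMeasure r).real (A ∩ Set.Iic k) := by
      have := measureReal_inter_add_sdiff (μ := poissonMeasure r) (s := Set.Iic k) (t := A)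
        MeasurableSet.of_discrete
      rw [Set.inter_comm A, Set.inter_comm, ← Set.sdiff_eq]
      linarith
    have h2 : (poissonMeasure r).real Aᶜ = 1 - (poissonMeasure r).real A :=
      probReal_compl_eq_one_sub MeasurableSet.of_discrete
    simp only [steinSolution, h1, h2]
    ring

/-- The solution is additive in `A`, and among the atoms of `A` only `k + 1` can contribute
positively to this increment. One-sided bounds suffice, since passing to `Aᶜ` changes the sign. -/
theorem steinSolution_diff_le (r : ℝ≥0) (hr : 0 < r) (A : Set ℕ) (k : ℕ) :
    steinSolution r A (k + 2) - steinSolution r A (k + 1) ≤ 1 / r := by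
  have hp : ∀ k, 0 < (poissonMeasure r).real {k} := fun k =>
    poissonMeasure_real_singleton_pos k hr
  have hr' : (0 : ℝ) < r := hr
  set P := poissonMeasure r
  have hy : ∀ B : Set ℕ, ∀ k, P.real B = P.real (B ∩ Set.Iic k) + P.real (B ∩ Set.Ioi k) := by
    intro B k
    have := measureReal_inter_add_sdiff (μ := P) (s := B) (t := Set.Iic k)
      MeasurableSet.of_discrete
    rw [← this, Set.sdiff_eq, Set.compl_Iic]
  have h1 := poisson_real_inter_Iic_succ r A k
  have h2 := poisson_real_inter_Iic_succ r Set.univ k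
  have h3 := poisson_real_singleton_succ r k
  have h4 := poisson_real_Ioi_succ_le r k
  have h5 := poisson_real_Iic_le r k
  have hu := fun k => hy Set.univ k
  simp only [Set.univ_inter, Set.mem_univ, Set.indicator_of_mem, one_mul, probReal_univ] at h2 hu
  have hp1 := hp k
  have hp2 := hp (k + 1)
  simp only [steinSolution]
  have hi : 0 ≤ A.indicator (fun _ => (1 : ℝ)) (k + 1) ∧
      A.indicator (fun _ => (1 : ℝ)) (k + 1) ≤ 1 := by
    by_cases h : k + 1 ∈ A <;> simp [h]
  have hyA := hy A (k + 1)
  have hx : 0 ≤ P.real (A ∩ Set.Iic k) := measureReal_nonneg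
  have hyn : 0 ≤ P.real (A ∩ Set.Ioi (k + 1)) := measureReal_nonneg
  have hu1 := hu k
  have hu2 := hu (k + 1)
  have hun : 0 ≤ P.real (Set.Iic (k + 1)) := measureReal_nonneg
  have htn : 0 ≤ P.real (Set.Ioi (k + 1)) := measureReal_nonneg
  have hun0 : 0 ≤ P.real (Set.Iic k) := measureReal_nonneg
  change ((P.real _ - P.real A * P.real _) / (r * P.real {k + 1})) -
    ((P.real _ - P.real A * P.real _) / (r * P.real {k})) ≤ _
  change _ = P.real (A ∩ Set.Iic k) + _ * P.real {k + 1} at h1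
  change _ = P.real (Set.Iic k) + P.real {k + 1} at h2
  change _ * P.real {k + 1} = r * P.real {k} at h3
  change _ * P.real (Set.Ioi (k + 1)) ≤ r * P.real (Set.Ioi k) at h4
  change r * P.real (Set.Iic k) ≤ _ * P.real (Set.Iic (k + 1)) at h5
  change P.real (A ∩ Set.Iic (k + 1)) = _ at h1
  change P.real (Set.Iic (k + 1)) = _ at h2
  generalize A.indicator (fun _ => (1 : ℝ)) (k + 1) = i at *
  generalize P.real {k} = p at *
  generalize P.real {k + 1} = q at *
  generalize P.real (A ∩ Set.Iic k) = x at *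
  generalize P.real (A ∩ Set.Iic (k + 1)) = x' at *
  generalize P.real (A ∩ Set.Ioi (k + 1)) = y at *
  generalize P.real (Set.Iic k) = u at *
  generalize P.real (Set.Iic (k + 1)) = u' at *
  generalize P.real (Set.Ioi k) = t at *
  generalize P.real (Set.Ioi (k + 1)) = t' at *
  generalize P.real A = a at *
  generalize (r : ℝ) = l at *
  have hK : (0 : ℝ) < (k : ℝ) + 1 := by positivity
  generalize (k : ℝ) + 1 = K at *
  rw [← h3]
  rw [div_sub_div _ _ (by positivity) (by positivity), div_le_div_iff₀ (by positivity) hr']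
  have key : (x' - a * u') * K - l * (x - a * u) ≤ K * q := by
    subst hyA
    subst h1
    have e1 : t = 1 - u := by linarith
    have e2 : t' = 1 - u' := by linarith
    -- Split by the part of `A` below, at and above `k + 1`: the outer two contribute nonpositive
    -- amounts, the middle one at most `K * q`.
    have : ((x + i * q) - (x + i * q + y) * u') * K - l * (x - (x + i * q + y) * u) =
        x * (K * t' - l * t) + i * q * (K * t' + l * u) - y * (K * u' - l * u) := by
      rw [e1, e2]; ring
    rw [this]
    have a1 : x * (K * t' - l * t) ≤ 0 := mul_nonpos_of_nonneg_of_nonpos hx (by linarith)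
    have a2 : 0 ≤ y * (K * u' - l * u) := mul_nonneg hyn (by linarith)
    have a3 : i * q * (K * t' + l * u) ≤ 1 * q * (K * t' + K * u') := by
      gcongr
      exact hi.2
    have a4 : 1 * q * (K * t' + K * u') = K * q := by rw [e2]; ring
    linarith
  have : ((x' - a * u') * (K * q) - l * q * (x - a * u)) * l =
    ((x' - a * u') * K - l * (x - a * u)) * (q * l) := by ring
  rw [this]
  calc _ ≤ K * q * (q * l) := by gcongr
    _ = _ := by ring

theorem abs_steinSolution_diff_le (r : ℝ≥0) (hr : 0 < r) (A : Set ℕ) (k : ℕ) :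
    |steinSolution r A (k + 2) - steinSolution r A (k + 1)| ≤ 1 / r := by
  rw [abs_le]
  have h := steinSolution_diff_le r hr Aᶜ k
  rw [steinSolution_compl, steinSolution_compl] at h
  exact ⟨by linarith, steinSolution_diff_le r hr A k⟩

end Stein

end UniformAttachment

namespace UniformAttachment

open scoped NNReal

/-! ### The Stein–Chen bound under local dependence. -/

section SteinChen

theorem abs_steinSolution_add_sub_le (r : ℝ≥0) (hr : 0 < r) (A : Set ℕ) (a d : ℕ) :
    |steinSolution r A (a + d + 1) - steinSolution r A (a + 1)| ≤ 1 / r * d := by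
  induction d with
  | zero => simp
  | succ d ih =>
    have h := abs_steinSolution_diff_le r hr A (a + d)
    have h2 := abs_sub_le (steinSolution r A (a + (d + 1) + 1)) (steinSolution r A (a + d + 1))
      (steinSolution r A (a + 1))
    push_cast
    have h3 : a + (d + 1) + 1 = a + d + 2 := by ring
    rw [h3] at h2 ⊢
    rw [mul_add, mul_one]
    linarith

variable {Ω ι : Type*} [MeasurableSpace Ω] [DiscreteMeasurableSpace Ω]

theorem integral_indicator_one_natCast (μ : Measure Ω) (T : Set Ω) :
    ∫ ω, ((T.indicator (fun _ => 1) ω : ℕ) : ℝ) ∂μ = μ.real T := by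
  have : (fun ω => ((T.indicator (fun _ => 1) ω : ℕ) : ℝ)) = T.indicator 1 := by
    ext ω
    by_cases h : ω ∈ T <;> simp [h]
  rw [this, integral_indicator_one MeasurableSet.of_discrete]

theorem integral_indicator_mul_indicator (μ : Measure Ω) (T U : Set Ω) :
    ∫ ω, ((T.indicator (fun _ => 1) ω : ℕ) : ℝ) * ((U.indicator (fun _ => 1) ω : ℕ) : ℝ) ∂μ =
      μ.real (T ∩ U) := by
  rw [← integral_indicator_one_natCast]
  congr 1
  ext ω
  by_cases h : ω ∈ T <;> by_cases h' : ω ∈ U <;> simp [h, h']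

variable [Finite Ω] [DecidableEq ι]

/-- The Stein–Chen bound for Poisson approximation of a sum of locally dependent indicators. -/
theorem abs_real_sub_poisson_real_le (μ : Measure Ω) [IsProbabilityMeasure μ] (s : Finset ι)
    (T : ι → Set Ω) (N : ι → Finset ι) (hiN : ∀ i ∈ s, i ∈ N i) (hNs : ∀ i ∈ s, N i ⊆ s)
    (hind : ∀ i ∈ s, ∀ g : ℕ → ℝ,
      ∫ ω, (((T i).indicator (fun _ => 1) ω : ℕ) : ℝ) *
        g (∑ j ∈ s \ N i, (T j).indicator (fun _ => 1) ω) ∂μ =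
      μ.real (T i) * ∫ ω, g (∑ j ∈ s \ N i, (T j).indicator (fun _ => 1) ω) ∂μ)
    (r : ℝ≥0) (hr : 0 < r) (hrs : (r : ℝ) = ∑ i ∈ s, μ.real (T i)) (A : Set ℕ) :
    |μ.real {ω | ∑ i ∈ s, (T i).indicator (fun _ => 1) ω ∈ A} - (poissonMeasure r).real A| ≤
      1 / r * ∑ i ∈ s, (∑ j ∈ N i, μ.real (T i) * μ.real (T j) +
        ∑ j ∈ (N i).erase i, μ.real (T i ∩ T j)) := by
  set X : ι → Ω → ℕ := fun i ω => (T i).indicator (fun _ => 1) ω with hX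
  set f := steinSolution r A with hf
  set W : Ω → ℕ := fun ω => ∑ i ∈ s, X i ω with hW
  set V : ι → Ω → ℕ := fun i ω => ∑ j ∈ s \ N i, X j ω with hV
  have hint : ∀ F : Ω → ℝ, Integrable F μ := fun F => Integrable.of_finite
  have hWV : ∀ i ∈ s, ∀ ω, W ω = V i ω + ∑ j ∈ N i, X j ω := fun i hi ω =>
    (Finset.sum_sdiff (hNs i hi)).symm
  have hXp : ∀ i, ∫ ω, (X i ω : ℝ) ∂μ = μ.real (T i) := fun i =>
    integral_indicator_one_natCast μ (T i)
  have hmain : μ.real {ω | W ω ∈ A} - (poissonMeasure r).real A =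
      ∑ i ∈ s, (μ.real (T i) * ∫ ω, f (W ω + 1) ∂μ - ∫ ω, (X i ω : ℝ) * f (W ω) ∂μ) := by
    have h1 : ∀ ω, ({ω | W ω ∈ A} : Set Ω).indicator (1 : Ω → ℝ) ω - (poissonMeasure r).real A =
        r * f (W ω + 1) - W ω * f (W ω) := by
      intro ω
      rw [hf, steinSolution_equation r hr A (W ω)]
      by_cases h : W ω ∈ A <;> simp [h]
    have h2 : μ.real {ω | W ω ∈ A} - (poissonMeasure r).real A =
        ∫ ω, (({ω | W ω ∈ A} : Set Ω).indicator (1 : Ω → ℝ) ω - (poissonMeasure r).real A) ∂μ := by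
      rw [integral_sub (hint _) (hint _), integral_indicator_one MeasurableSet.of_discrete]
      simp
    rw [h2]
    simp_rw [h1]
    rw [integral_sub (hint _) (hint _), integral_const_mul, hrs, Finset.sum_sub_distrib,
      Finset.sum_mul, ← integral_finsetSum _ (fun _ _ => hint _)]
    congr 2
    ext ω
    rw [hW]
    push_cast
    rw [Finset.sum_mul]
  have hterm : ∀ i ∈ s,
      |μ.real (T i) * ∫ ω, f (W ω + 1) ∂μ - ∫ ω, (X i ω : ℝ) * f (W ω) ∂μ| ≤
      1 / r * (∑ j ∈ N i, μ.real (T i) * μ.real (T j) +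
        ∑ j ∈ (N i).erase i, μ.real (T i ∩ T j)) := by
    intro i hi
    have hi1 := hind i hi (fun k => f (k + 1))
    -- Compare both terms with `f (V i + 1)`, where `V i` omits the neighbourhood of `i`; by `hind`
    -- the two comparison terms cancel. The increments of `f` then count the neighbours present.
    have hsplit : μ.real (T i) * ∫ ω, f (W ω + 1) ∂μ - ∫ ω, (X i ω : ℝ) * f (W ω) ∂μ =
        μ.real (T i) * ∫ ω, (f (W ω + 1) - f (V i ω + 1)) ∂μ -
          ∫ ω, (X i ω : ℝ) * (f (W ω) - f (V i ω + 1)) ∂μ := by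
      simp_rw [mul_sub]
      rw [integral_sub (hint _) (hint _), integral_sub (hint _) (hint _), mul_sub]
      change ∫ ω, (X i ω : ℝ) * f (V i ω + 1) ∂μ = _ at hi1
      rw [hi1]
      ring
    rw [hsplit, mul_add]
    refine (abs_sub _ _).trans (add_le_add ?_ ?_)
    · rw [abs_mul, abs_of_nonneg (measureReal_nonneg (μ := μ)), ← Finset.mul_sum, mul_left_comm]
      refine mul_le_mul_of_nonneg_left ?_ measureReal_nonneg
      refine (abs_integral_le_integral_abs).trans ?_
      calc ∫ ω, |f (W ω + 1) - f (V i ω + 1)| ∂μ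
          ≤ ∫ ω, 1 / r * ∑ j ∈ N i, (X j ω : ℝ) ∂μ := by
            refine integral_mono (hint _) (hint _) fun ω => ?_
            have := abs_steinSolution_add_sub_le r hr A (V i ω) (∑ j ∈ N i, X j ω)
            rw [← hWV i hi] at this
            push_cast at this
            exact this
        _ = _ := by
            rw [integral_const_mul, integral_finsetSum _ (fun _ _ => hint _)]
            simp_rw [hXp]
    · refine (abs_integral_le_integral_abs).trans ?_
      calc ∫ ω, |(X i ω : ℝ) * (f (W ω) - f (V i ω + 1))| ∂μ
          ≤ ∫ ω, 1 / r * ∑ j ∈ (N i).erase i, (X i ω : ℝ) * (X j ω : ℝ) ∂μ := by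
            refine integral_mono (hint _) (hint _) fun ω => ?_
            by_cases h : ω ∈ T i
            · have hx : X i ω = 1 := by simp [hX, h]
              have := abs_steinSolution_add_sub_le r hr A (V i ω) (∑ j ∈ (N i).erase i, X j ω)
              -- On `T i` the indicator `X i` itself supplies the shift by one, so only the other
              -- neighbours remain.
              have hw : V i ω + ∑ j ∈ (N i).erase i, X j ω + 1 = W ω := by
                rw [hWV i hi, ← Finset.add_sum_erase _ _ (hiN i hi), hx]
                ring
              rw [hw] at this
              push_cast at this
              simpa [hx] using this
            · have hx : X i ω = 0 := by simp [hX, h]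
              simp [hx]
        _ = _ := by
            rw [integral_const_mul, integral_finsetSum _ (fun _ _ => hint _)]
            simp_rw [hX, integral_indicator_mul_indicator]
  rw [hmain, Finset.mul_sum]
  exact (Finset.abs_sum_le_sum_abs _ _).trans (Finset.sum_le_sum hterm)

end SteinChen

end UniformAttachment

namespace UniformAttachment

/-! ### Schur test for the kernel `1 / max u v` and sums over closed walks. -/

section Kernel

theorem sum_inv_sqrt_le (n : ℕ) : ∑ v ∈ Finset.Icc 1 n, (√(v : ℝ))⁻¹ ≤ 2 * √(n : ℝ) := by
  induction n with
  | zero => simp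
  | succ n ih =>
    rw [Finset.sum_Icc_succ_top (by omega)]
    have hb : 0 < √((n + 1 : ℕ) : ℝ) := Real.sqrt_pos.2 (by positivity)
    have ha : 0 ≤ √(n : ℝ) := Real.sqrt_nonneg _
    have hb2 : √((n + 1 : ℕ) : ℝ) ^ 2 = √(n : ℝ) ^ 2 + 1 := by
      rw [Real.sq_sqrt (by positivity), Real.sq_sqrt (by positivity)]
      push_cast; ring
    generalize √((n + 1 : ℕ) : ℝ) = b at *
    generalize √(n : ℝ) = a at *
    have hab : b⁻¹ ≤ 2 * b - 2 * a := by
      rw [inv_le_iff_one_le_mul₀ hb]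
      nlinarith [sq_nonneg (b - a)]
    linarith

/-- The range `v ≤ u` contributes at most `2/√u` by `sum_inv_sqrt_le`, and the tail `∑ v^(-3/2)`
over `v > u` at most another `2/√u`. -/
theorem sum_inv_max_mul_inv_sqrt_le (u n : ℕ) (hu : 1 ≤ u) :
    ∑ v ∈ Finset.Icc 1 n, 1 / (max u v : ℝ) * (√(v : ℝ))⁻¹ ≤ 4 * (√(u : ℝ))⁻¹ := by
  have hu0 : 0 < √(u : ℝ) := Real.sqrt_pos.2 (by positivity)
  have hu2 : √(u : ℝ) ^ 2 = u := Real.sq_sqrt (by positivity)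
  have small : ∀ n ≤ u, ∑ v ∈ Finset.Icc 1 n, 1 / (max u v : ℝ) * (√(v : ℝ))⁻¹ ≤
      2 * (√(u : ℝ))⁻¹ := by
    intro n hn
    calc ∑ v ∈ Finset.Icc 1 n, 1 / (max u v : ℝ) * (√(v : ℝ))⁻¹
        = 1 / u * ∑ v ∈ Finset.Icc 1 n, (√(v : ℝ))⁻¹ := by
          rw [Finset.mul_sum]
          refine Finset.sum_congr rfl fun v hv => ?_
          rw [max_eq_left]
          exact_mod_cast (Finset.mem_Icc.1 hv).2.trans hn
      _ ≤ 1 / u * (2 * √(u : ℝ)) := by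
          gcongr
          refine (sum_inv_sqrt_le n).trans ?_
          gcongr
      _ = 2 * (√(u : ℝ))⁻¹ := by
          rw [← hu2]
          field_simp
          simp
  -- The subtracted term is the slack that makes the tail telescope.
  have large : ∀ k, ∑ v ∈ Finset.Icc 1 (u + k), 1 / (max u v : ℝ) * (√(v : ℝ))⁻¹ ≤
      4 * (√(u : ℝ))⁻¹ - 2 * (√((u + k : ℕ) : ℝ))⁻¹ := by
    intro k
    induction k with
    | zero =>
      have := small u le_rfl
      simp only [add_zero]
      linarith
    | succ k ih =>
      rw [← add_assoc, Finset.sum_Icc_succ_top (by omega), max_eq_right (by push_cast; linarith)]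
      have hb : 0 < √((u + k + 1 : ℕ) : ℝ) := Real.sqrt_pos.2 (by positivity)
      have ha : 0 < √((u + k : ℕ) : ℝ) := Real.sqrt_pos.2 (by positivity)
      have hb2 : √((u + k + 1 : ℕ) : ℝ) ^ 2 = √((u + k : ℕ) : ℝ) ^ 2 + 1 := by
        rw [Real.sq_sqrt (by positivity), Real.sq_sqrt (by positivity)]
        push_cast; ring
      have hb3 : ((u + k + 1 : ℕ) : ℝ) = √((u + k + 1 : ℕ) : ℝ) ^ 2 :=
        (Real.sq_sqrt (by positivity)).symm
      rw [hb3, Real.sqrt_sq hb.le]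
      generalize √((u + k + 1 : ℕ) : ℝ) = b at *
      generalize √((u + k : ℕ) : ℝ) = a at *
      have hab : 1 / b ^ 2 * b⁻¹ ≤ 2 * a⁻¹ - 2 * b⁻¹ := by
        have h1 : 1 ≤ 2 * b * (b - a) := by nlinarith [sq_nonneg (b - a)]
        have hle : a ≤ b := by nlinarith
        have e : 2 * a⁻¹ - 2 * b⁻¹ - 1 / b ^ 2 * b⁻¹ = (2 * b ^ 2 * (b - a) - a) / (a * b ^ 3) := by
          field_simp
        have : 0 ≤ (2 * b ^ 2 * (b - a) - a) / (a * b ^ 3) := by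
          apply div_nonneg _ (by positivity)
          nlinarith
        linarith
      linarith
  rcases le_total n u with h | h
  · refine (small n h).trans ?_
    have : 0 < (√(u : ℝ))⁻¹ := by positivity
    linarith
  · obtain ⟨k, rfl⟩ := Nat.exists_eq_add_of_le h
    refine (large k).trans ?_
    have : 0 ≤ (√((u + k : ℕ) : ℝ))⁻¹ := by positivity
    linarith

theorem one_div_max_le (u v : ℕ) (hu : 1 ≤ u) (hv : 1 ≤ v) :
    1 / (max u v : ℝ) ≤ (√(u : ℝ))⁻¹ * (√(v : ℝ))⁻¹ := by
  have hu0 : 0 < √(u : ℝ) := Real.sqrt_pos.2 (by positivity)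
  have hv0 : 0 < √(v : ℝ) := Real.sqrt_pos.2 (by positivity)
  rw [← mul_inv, one_div]
  apply inv_anti₀ (by positivity)
  have h : √(u : ℝ) ≤ √(max u v : ℝ) := Real.sqrt_le_sqrt (le_max_left _ _)
  have h' : √(v : ℝ) ≤ √(max u v : ℝ) := Real.sqrt_le_sqrt (le_max_right _ _)
  calc √(u : ℝ) * √(v : ℝ) ≤ √(max u v : ℝ) * √(max u v : ℝ) := by gcongr
    _ = _ := Real.mul_self_sqrt (by positivity)

theorem sum_walk_le {V : Type*} [Fintype V] (K : V → V → ℝ) (g p : V → ℝ)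
    (hK : ∀ u v, 0 ≤ K u v) (hp : ∀ u, 0 ≤ p u) (C : ℝ) (hC : 0 ≤ C)
    (hg : ∀ u, ∑ v, K u v * g v ≤ C * g u) (r : ℕ) :
    ∑ w : Fin (r + 1) → V, p (w 0) * (∏ i : Fin r, K (w i.castSucc) (w i.succ)) *
      g (w (Fin.last r)) ≤ C ^ r * ∑ x, p x * g x := by
  induction r with
  | zero =>
    rw [← (Equiv.funUnique (Fin 1) V).symm.sum_comp]
    simp
  | succ r ih =>
    rw [← (Fin.snocEquiv fun _ : Fin (r + 2) => V).sum_comp, Fintype.sum_prod_type_right]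
    calc _ = ∑ w : Fin (r + 1) → V, p (w 0) * (∏ i : Fin r, K (w i.castSucc) (w i.succ)) *
          ∑ y, K (w (Fin.last r)) y * g y := by
          refine Finset.sum_congr rfl fun w _ => ?_
          rw [Finset.mul_sum]
          refine Finset.sum_congr rfl fun y _ => ?_
          have h0 : (Fin.snoc w y : Fin (r + 2) → V) 0 = w 0 :=
            Fin.snoc_castSucc (α := fun _ => V) y w 0
          simp only [Fin.snocEquiv_apply, Fin.prod_univ_castSucc, Fin.succ_last, Fin.snoc_last,
            Fin.snoc_castSucc, h0, ← Fin.castSucc_succ]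
          ring
      _ ≤ ∑ w : Fin (r + 1) → V, p (w 0) * (∏ i : Fin r, K (w i.castSucc) (w i.succ)) *
          (C * g (w (Fin.last r))) := by
          refine Finset.sum_le_sum fun w _ => ?_
          refine mul_le_mul_of_nonneg_left (hg _) (mul_nonneg (hp _) ?_)
          exact Finset.prod_nonneg fun _ _ => hK _ _
      _ = C * ∑ w : Fin (r + 1) → V, p (w 0) * (∏ i : Fin r, K (w i.castSucc) (w i.succ)) *
          g (w (Fin.last r)) := by
          rw [Finset.mul_sum]
          refine Finset.sum_congr rfl fun w _ => ?_
          ring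
      _ ≤ C * (C ^ r * ∑ x, p x * g x) := by gcongr
      _ = _ := by ring

/-- Closed walks based in `A` whose last step is a jump, where the other steps may also be free
moves inside `A`. -/
theorem sum_closed_walk_le (n r L : ℕ) (A : Finset (Finset.Icc 1 n)) (hA : A.card ≤ L) :
    ∑ w : Fin (r + 1) → Finset.Icc 1 n, (if w 0 ∈ A then (1 : ℝ) else 0) *
      ((∏ i : Fin r, (2 / (max (w i.castSucc : ℕ) (w i.succ : ℕ) : ℝ) +
        if w i.castSucc ∈ A ∧ w i.succ ∈ A then 1 else 0)) *
      (2 / (max (w (Fin.last r) : ℕ) (w 0 : ℕ) : ℝ))) ≤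
    2 * (9 + 2 * (L : ℝ) ^ 2 + L) ^ r * (1 + L) * ∑ x ∈ A, 1 / ((x : ℕ) : ℝ) := by
  classical
  set s : Finset.Icc 1 n → ℝ := fun x => (√((x : ℕ) : ℝ))⁻¹ with hs
  set S : ℝ := ∑ x ∈ A, s x with hS
  have hpos : ∀ x : Finset.Icc 1 n, 1 ≤ (x : ℕ) := fun x => (Finset.mem_Icc.1 x.2).1
  have hs0 : ∀ x, 0 ≤ s x := fun x => by positivity
  have hs1 : ∀ x, s x ≤ 1 := fun x => by
    apply inv_le_one_of_one_le₀
    rw [Real.one_le_sqrt]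
    exact_mod_cast hpos x
  have hs2 : ∀ x, s x ^ 2 = 1 / ((x : ℕ) : ℝ) := fun x => by
    rw [hs, inv_pow, Real.sq_sqrt (by positivity), one_div]
  have hS0 : 0 ≤ S := Finset.sum_nonneg fun x _ => hs0 x
  have hL : (A.card : ℝ) ≤ L := by exact_mod_cast hA
  have hSL : S ≤ L := by
    calc S ≤ ∑ x ∈ A, (1 : ℝ) := Finset.sum_le_sum fun x _ => hs1 x
      _ = A.card := by simp
      _ ≤ L := hL
  have hS2 : S ^ 2 ≤ L * ∑ x ∈ A, 1 / ((x : ℕ) : ℝ) := by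
    calc S ^ 2 ≤ A.card * ∑ x ∈ A, s x ^ 2 := sq_sum_le_card_mul_sum_sq
      _ = A.card * ∑ x ∈ A, 1 / ((x : ℕ) : ℝ) := by simp_rw [hs2]
      _ ≤ _ := by gcongr
  have hk : ∀ u v : Finset.Icc 1 n, 2 / (max (u : ℕ) (v : ℕ) : ℝ) ≤ 2 * (s u * s v) := by
    intro u v
    have := one_div_max_le u v (hpos u) (hpos v)
    rw [show (2 : ℝ) / (max (u : ℕ) (v : ℕ) : ℝ) = 2 * (1 / (max (u : ℕ) (v : ℕ) : ℝ)) by ring]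
    gcongr
  set χ : Finset.Icc 1 n → ℝ := fun u => if u ∈ A then 1 else 0 with hχ
  have hχ0 : ∀ u, 0 ≤ χ u := fun u => by
    rw [hχ]; dsimp only; split_ifs <;> norm_num
  set K : Finset.Icc 1 n → Finset.Icc 1 n → ℝ := fun u v =>
    2 / (max (u : ℕ) (v : ℕ) : ℝ) + if u ∈ A ∧ v ∈ A then 1 else 0 with hKdef
  have hK' : ∀ u v, K u v = 2 / (max (u : ℕ) (v : ℕ) : ℝ) + χ u * χ v := by
    intro u v
    simp only [hKdef, hχ]
    by_cases h : u ∈ A <;> by_cases h' : v ∈ A <;> simp [h, h']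
  have hK0 : ∀ u v, 0 ≤ K u v := fun u v => by
    rw [hK']
    exact add_nonneg (by positivity) (mul_nonneg (hχ0 u) (hχ0 v))
  have hχsum : ∀ F : Finset.Icc 1 n → ℝ, ∑ v, χ v * F v = ∑ v ∈ A, F v := by
    intro F
    simp only [hχ, ite_mul, one_mul, zero_mul]
    rw [← Finset.sum_filter, Finset.filter_mem_eq_inter, Finset.univ_inter]
  -- The function `s` alone fails for free moves, which carry any point of `A` to all of `A`; adding
  -- `S` on `A` repairs this. Jumps cost `8 + 2 * L ^ 2`, free moves `1 + L`.
  set g : Finset.Icc 1 n → ℝ := fun u => s u + χ u * S with hg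
  have hKg : ∀ u, ∑ v, K u v * g v ≤ (9 + 2 * (L : ℝ) ^ 2 + L) * g u := by
    intro u
    have e1 : ∑ v, K u v * g v = 2 * ∑ v : Finset.Icc 1 n, 1 / (max (u : ℕ) (v : ℕ) : ℝ) * s v +
        (∑ v ∈ A, 2 / (max (u : ℕ) (v : ℕ) : ℝ)) * S + χ u * (S + A.card * S) := by
      have : ∀ v, K u v * g v = 2 * (1 / (max (u : ℕ) (v : ℕ) : ℝ) * s v) +
        χ v * (2 / (max (u : ℕ) (v : ℕ) : ℝ) * S) + (χ u * (χ v * s v) +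
          χ u * (χ v * (χ v * S))) := by
        intro v
        rw [hK', hg]
        ring
      simp_rw [this]
      rw [Finset.sum_add_distrib, Finset.sum_add_distrib, Finset.sum_add_distrib, hχsum,
        ← Finset.mul_sum, ← Finset.mul_sum, ← Finset.mul_sum, hχsum, hχsum, Finset.sum_mul]
      have : ∑ v ∈ A, χ v * S = A.card * S := by
        rw [← Finset.sum_mul]
        congr 1
        rw [hχ, Finset.sum_congr rfl (g := fun _ => (1 : ℝ)) (fun v hv => by simp [hv])]
        simp
      rw [this]
      ring
    have e2 : ∑ v : Finset.Icc 1 n, 1 / (max (u : ℕ) (v : ℕ) : ℝ) * s v ≤ 4 * s u := by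
      have := sum_inv_max_mul_inv_sqrt_le u n (hpos u)
      rw [← Finset.sum_coe_sort] at this
      exact this
    have e3 : (∑ v ∈ A, 2 / (max (u : ℕ) (v : ℕ) : ℝ)) * S ≤ 2 * L ^ 2 * s u := by
      calc (∑ v ∈ A, 2 / (max (u : ℕ) (v : ℕ) : ℝ)) * S ≤ (∑ v ∈ A, 2 * (s u * s v)) * S := by
            gcongr
            exact hk _ _
        _ = 2 * (S * S) * s u := by
            rw [← Finset.mul_sum, ← Finset.mul_sum]; ring
        _ ≤ 2 * (L * L) * s u := by
            have := hs0 u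
            gcongr
        _ = _ := by ring
    have e4 : χ u * (S + A.card * S) ≤ χ u * (S + L * S) := by
      have := hχ0 u
      gcongr
    rw [e1, hg]
    have p1 := mul_nonneg (hχ0 u) hS0
    have p2 : 0 ≤ (L : ℝ) * s u := mul_nonneg (by positivity) (hs0 u)
    have p3 : 0 ≤ (8 + 2 * (L : ℝ) ^ 2) * (χ u * S) := mul_nonneg (by positivity) p1
    have p4 := hs0 u
    nlinarith
  have hwalk := sum_walk_le K g (fun x => 2 * (χ x * s x)) hK0
    (fun u => mul_nonneg zero_le_two (mul_nonneg (hχ0 u) (hs0 u))) _ (by positivity) hKg r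
  calc _ ≤ ∑ w : Fin (r + 1) → Finset.Icc 1 n, 2 * (χ (w 0) * s (w 0)) *
        (∏ i : Fin r, K (w i.castSucc) (w i.succ)) * g (w (Fin.last r)) := by
        refine Finset.sum_le_sum fun w _ => ?_
        change χ (w 0) * ((∏ i : Fin r, K (w i.castSucc) (w i.succ)) * _) ≤ _
        have h1 : 2 / (max (w (Fin.last r) : ℕ) (w 0 : ℕ) : ℝ) ≤ 2 * (g (w (Fin.last r)) * s (w 0)) := by
          refine (hk _ _).trans ?_
          have := mul_nonneg (hχ0 (w (Fin.last r))) hS0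
          have := hs0 (w 0)
          gcongr
          rw [hg]
          linarith
        have h2 : 0 ≤ ∏ i : Fin r, K (w i.castSucc) (w i.succ) :=
          Finset.prod_nonneg fun _ _ => hK0 _ _
        have h3 := hχ0 (w 0)
        calc _ ≤ χ (w 0) * ((∏ i : Fin r, K (w i.castSucc) (w i.succ)) *
              (2 * (g (w (Fin.last r)) * s (w 0)))) := by gcongr
          _ = _ := by ring
    _ ≤ _ := hwalk
    -- The closing jump supplies a second factor `s (w 0)`, whence `s x ^ 2 = 1 / x`; Cauchy–Schwarz
    -- (`hS2`) absorbs `S ^ 2`.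
    _ = 2 * (9 + 2 * (L : ℝ) ^ 2 + L) ^ r * ∑ x ∈ A, (s x ^ 2 + s x * S) := by
        rw [mul_comm (2 : ℝ) ((9 + 2 * (L : ℝ) ^ 2 + L) ^ r), mul_assoc _ (2 : ℝ)]
        congr 1
        rw [← hχsum, Finset.mul_sum]
        refine (Finset.sum_congr rfl fun x _ => ?_)
        rw [hg]
        by_cases h : x ∈ A
        · simp only [hχ, h, if_true]; ring
        · simp only [hχ, h, if_false]; ring
    _ = 2 * (9 + 2 * (L : ℝ) ^ 2 + L) ^ r * (∑ x ∈ A, 1 / ((x : ℕ) : ℝ) + S ^ 2) := by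
        rw [Finset.sum_add_distrib, ← Finset.sum_mul]
        simp_rw [hs2]
        ring
    _ ≤ 2 * (9 + 2 * (L : ℝ) ^ 2 + L) ^ r * (∑ x ∈ A, 1 / ((x : ℕ) : ℝ) +
          L * ∑ x ∈ A, 1 / ((x : ℕ) : ℝ)) := by gcongr
    _ = _ := by ring

end Kernel

end UniformAttachment

namespace UniformAttachment

/-! ### Cycles as edge sets of closed walks. -/

section Encoding

/-- The `i`-th edge of the closed walk through the vertices `v` with edge labels `a`. -/
def walkEdge {m r : ℕ} (v : Fin (r + 1) → ℕ) (a : Fin (r + 1) → Fin m) (i : Fin (r + 1)) :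
    ℕ × ℕ × Fin m :=
  (max (v i) (v (i + 1)), min (v i) (v (i + 1)), a i)

/-- The edge sets of the `(r + 1)`-cycles of the complete multigraph. -/
noncomputable def cycleSets (m r n : ℕ) : Finset (Finset (ℕ × ℕ × Fin m)) :=
  ((Finset.univ : Finset ((Fin (r + 1) → Finset.Icc 1 n) × (Fin (r + 1) → Fin m))).filter
    -- Injectivity of the edges matters for 2-cycles, where it forces distinct labels.
    fun p => Function.Injective p.1 ∧ Function.Injective (walkEdge (fun i => (p.1 i : ℕ)) p.2)).image
    fun p => Finset.univ.image (walkEdge (fun i => (p.1 i : ℕ)) p.2)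

theorem mem_cycleSets {m r n : ℕ} {E : Finset (ℕ × ℕ × Fin m)} :
    E ∈ cycleSets m r n ↔ ∃ (v : Fin (r + 1) → Finset.Icc 1 n) (a : Fin (r + 1) → Fin m),
      Function.Injective v ∧ Function.Injective (walkEdge (fun i => (v i : ℕ)) a) ∧
        Finset.univ.image (walkEdge (fun i => (v i : ℕ)) a) = E := by
  simp [cycleSets, and_assoc]

/-- The event that all edges of `E` are chosen. -/
def presentEvent {m : ℕ} (n : ℕ) (E : Finset (ℕ × ℕ × Fin m)) : Set (Choices m n) :=
  {ω | ∀ e ∈ E, ∃ s : Finset.Icc 2 n × Fin m, ((s.1 : ℕ), (ω s : ℕ), s.2) = e}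

theorem fin_ne_add_one {r : ℕ} (hr : 1 ≤ r) (i : Fin (r + 1)) : i ≠ i + 1 := by
  intro h
  have h1 : (1 : Fin (r + 1)) = 0 := by simpa using h.symm
  have := congrArg Fin.val h1
  rw [Fin.val_one', Fin.val_zero, Nat.mod_eq_of_lt (by omega)] at this
  omega

theorem attachmentGraph_isLink {m n : ℕ} {ω : Choices m n} {e : ℕ × ℕ × Fin m} {x y : ℕ} :
    (attachmentGraph ω).IsLink e x y ↔
      (∃ s : Finset.Icc 2 n × Fin m, ((s.1 : ℕ), (ω s : ℕ), s.2) = e) ∧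
        (completeMultigraph m n).IsLink e x y :=
  Iff.rfl

theorem isCycleGraph_succ_iff {α β : Type*} {r : ℕ} {H : Graph α β} :
    IsCycleGraph (r + 1) H ↔ ∃ (v : Fin (r + 1) → α) (e : Fin (r + 1) → β),
      Function.Injective v ∧ Function.Injective e ∧ H.vertexSet = Set.range v ∧
        H.edgeSet = Set.range e ∧ ∀ i, H.IsLink (e i) (v i) (v (i + 1)) :=
  Iff.rfl

/-- A cycle has no isolated vertices, so inside `G` it is determined by its edge set. This lets
`cycleCount_eq` count edge sets instead of subgraphs. -/
theorem IsCycleGraph.mem_vertexSet_iff {α β : Type*} {r : ℕ} {H G : Graph α β}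
    (hH : IsCycleGraph (r + 1) H) (hG : H ≤ G) (x : α) :
    x ∈ H.vertexSet ↔ ∃ e ∈ H.edgeSet, ∃ y, G.IsLink e x y := by
  obtain ⟨v, e, -, -, hV, hE, hl⟩ := isCycleGraph_succ_iff.1 hH
  constructor
  · intro hx
    rw [hV] at hx
    obtain ⟨i, rfl⟩ := hx
    exact ⟨e i, (hl i).edge_mem, _, hG.isLink_mono (hl i)⟩
  · rintro ⟨f, hf, y, hy⟩
    obtain ⟨a, b, hab⟩ := H.exists_isLink_of_mem_edgeSet hf
    rcases hy.left_eq_or_eq (hG.isLink_mono hab) with rfl | rfl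
    · exact hab.left_mem
    · exact hab.right_mem

theorem cycleCount_eq {m r n : ℕ} (hr : 1 ≤ r) (ω : Choices m n) :
    cycleCount m (r + 1) n ω =
      ∑ E ∈ cycleSets m r n, (presentEvent n E).indicator (fun _ => 1) ω := by
  classical
  have hR : ∑ E ∈ cycleSets m r n, (presentEvent n E).indicator (fun _ => 1) ω =
      ((cycleSets m r n).filter fun E => ω ∈ presentEvent n E).card := by
    rw [Finset.card_filter]
    exact Finset.sum_congr rfl fun E _ => by simp [Set.indicator_apply]
  rw [hR, cycleCount, ← Set.ncard_coe_finset,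
    ← Set.ncard_image_of_injective _ (Finset.coe_injective (α := ℕ × ℕ × Fin m)),
    ← Set.InjOn.ncard_image (f := Graph.edgeSet)]
  · congr 1
    ext F
    simp only [Set.mem_image, Set.mem_ofPred_eq, Finset.coe_filter]
    constructor
    · rintro ⟨H, ⟨hle, hcyc⟩, rfl⟩
      obtain ⟨v, e, hv, he, hV, hE, hl⟩ := isCycleGraph_succ_iff.1 hcyc
      have hG := fun i => attachmentGraph_isLink.1 (hle.isLink_mono (hl i))
      have hvm : ∀ i, v i ∈ Finset.Icc 1 n := fun i => by
        have := (completeMultigraph m n).left_mem_of_isLink (hG i).2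
        exact Finset.mem_Icc.2 this
      have hwe : walkEdge v (fun i => (e i).2.2) = e := by
        funext i
        obtain ⟨⟨h1, h2, h3⟩, h⟩ := (hG i).2
        refine Prod.ext ?_ (Prod.ext ?_ rfl)
        · simp only [walkEdge]; omega
        · simp only [walkEdge]; omega
      refine ⟨Finset.univ.image e, ⟨mem_cycleSets.2 ⟨fun i => ⟨v i, hvm i⟩, fun i => (e i).2.2,
        fun i j hij => hv (congrArg Subtype.val hij), ?_, ?_⟩, ?_⟩, ?_⟩
      · change Function.Injective (walkEdge v (fun i => (e i).2.2))
        rwa [hwe]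
      · change Finset.univ.image (walkEdge v (fun i => (e i).2.2)) = _
        rw [hwe]
      · intro f hf
        obtain ⟨i, -, rfl⟩ := Finset.mem_image.1 hf
        exact (hG i).1
      · rw [hE]; simp
    · rintro ⟨E, ⟨hE, hω⟩, rfl⟩
      obtain ⟨v, a, hv, he, rfl⟩ := mem_cycleSets.1 hE
      have hlink : ∀ i, (completeMultigraph m n).IsLink (walkEdge (fun i => (v i : ℕ)) a i)
          (v i) (v (i + 1)) := by
        intro i
        have h1 := Finset.mem_Icc.1 (v i).2
        have h2 := Finset.mem_Icc.1 (v (i + 1)).2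
        have h3 : (v i : ℕ) ≠ v (i + 1) := fun h =>
          fin_ne_add_one hr i (hv (Subtype.ext h))
        refine ⟨?_, ?_⟩ <;> simp only [walkEdge] <;> omega
      let H : Graph ℕ (ℕ × ℕ × Fin m) :=
        { vertexSet := Set.range fun i => (v i : ℕ)
          IsLink := fun e x y => (completeMultigraph m n).IsLink e x y ∧
            e ∈ Set.range (walkEdge (fun i => (v i : ℕ)) a)
          isLink_symm := fun _ _ => ⟨fun _ _ h => ⟨h.1.symm, h.2⟩⟩
          eq_or_eq_of_isLink_of_isLink := fun _ _ _ _ _ h h' => h.1.left_eq_or_eq h'.1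
          left_mem_of_isLink := by
            rintro _ x y ⟨h, i, rfl⟩
            rcases h.left_eq_or_eq (hlink i) with rfl | rfl
            · exact ⟨i, rfl⟩
            · exact ⟨i + 1, rfl⟩ }
      refine ⟨H, ⟨⟨?_, ?_⟩, isCycleGraph_succ_iff.2 ⟨fun i => v i, _,
        fun i j hij => hv (Subtype.ext hij), he, rfl, ?_, fun i => ⟨hlink i, i, rfl⟩⟩⟩, ?_⟩
      · rintro _ ⟨i, rfl⟩
        exact Finset.mem_Icc.1 (v i).2
      · rintro e x y ⟨h, i, rfl⟩
        exact attachmentGraph_isLink.2 ⟨hω _ (Finset.mem_image_of_mem _ (Finset.mem_univ i)), h⟩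
      · ext e
        exact ⟨fun ⟨x, y, h⟩ => h.2, fun ⟨i, h⟩ => ⟨_, _, h ▸ hlink i, i, h⟩⟩
      · ext e
        rw [Finset.coe_image, Finset.coe_univ, Set.image_univ]
        exact ⟨fun ⟨x, y, h⟩ => h.2, fun ⟨i, h⟩ => ⟨_, _, h ▸ hlink i, i, h⟩⟩
  · rintro H₁ ⟨hle₁, hc₁⟩ H₂ ⟨hle₂, hc₂⟩ hE
    refine Graph.Compatible.ext ?_ hE (Graph.Compatible.of_le_le hle₁ hle₂)
    ext x
    rw [hc₁.mem_vertexSet_iff hle₁, hc₂.mem_vertexSet_iff hle₂, hE]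

end Encoding

end UniformAttachment

namespace UniformAttachment

/-! ### Probabilities and independence of the events that cycles are present. -/

section Probability

/-- The probability that the edges of `E` are present, when they use distinct choices. -/
noncomputable def edgeWeight {m : ℕ} (E : Finset (ℕ × ℕ × Fin m)) : ℝ :=
  ∏ e ∈ E, 1 / ((e.1 : ℝ) - 1)

/-- Two edge sets share a choice if some vertex and label occur in both. -/
def ShareChoice {m : ℕ} (E F : Finset (ℕ × ℕ × Fin m)) : Prop :=
  ∃ e ∈ E, ∃ f ∈ F, e.1 = f.1 ∧ e.2.2 = f.2.2

theorem mem_presentEvent_iff {m n : ℕ} {E : Finset (ℕ × ℕ × Fin m)}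
    (hE : ∀ e ∈ E, 1 ≤ e.2.1 ∧ e.2.1 < e.1 ∧ e.1 ≤ n) (ω : Choices m n) :
    ω ∈ presentEvent n E ↔ ∀ s : Finset.Icc 2 n × Fin m, ∀ e ∈ E,
      e.1 = s.1 → e.2.2 = s.2 → (ω s : ℕ) = e.2.1 := by
  constructor
  · intro h s e he h1 h2
    obtain ⟨t, ht⟩ := h e he
    have : t = s := by
      refine Prod.ext (Subtype.ext ?_) ?_
      · rw [← h1, ← ht]
      · rw [← h2, ← ht]
    rw [← this, ← ht]
  · intro h e he
    obtain ⟨h1, h2, h3⟩ := hE e he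
    refine ⟨(⟨e.1, Finset.mem_Icc.2 ⟨by omega, h3⟩⟩, e.2.2), ?_⟩
    refine Prod.ext rfl (Prod.ext ?_ rfl)
    exact h _ e he rfl rfl

/-- Two different edges in one slot would need two values of the same choice. -/
theorem presentEvent_eq_empty {m n : ℕ} {E : Finset (ℕ × ℕ × Fin m)}
    (h : ¬ Set.InjOn (fun e : ℕ × ℕ × Fin m => (e.1, e.2.2)) E) : presentEvent n E = ∅ := by
  rw [Set.eq_empty_iff_forall_notMem]
  intro ω hω
  apply h
  intro e he f hf hef
  obtain ⟨s, hs⟩ := hω e he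
  obtain ⟨t, ht⟩ := hω f hf
  have : s = t := by
    simp only [Prod.mk.injEq] at hef
    refine Prod.ext (Subtype.ext ?_) ?_
    · rw [← hs, ← ht] at hef; exact hef.1
    · rw [← hs, ← ht] at hef; exact hef.2
  rw [← hs, ← ht, this]

theorem uniformOn_real_singleton (j : ℕ) (hj : 2 ≤ j) (x : Finset.Ico 1 j) :
    (uniformOn (Set.univ : Set (Finset.Ico 1 j))).real {x} = 1 / ((j : ℝ) - 1) := by
  rw [measureReal_def, uniformOn_univ, Measure.count_singleton, Fintype.card_coe, Nat.card_Ico,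
    ENNReal.toReal_div, ENNReal.toReal_one, ENNReal.toReal_natCast, Nat.cast_sub (by omega)]
  simp

theorem presentEvent_real_eq {m n : ℕ} {E : Finset (ℕ × ℕ × Fin m)}
    (hE : ∀ e ∈ E, 1 ≤ e.2.1 ∧ e.2.1 < e.1 ∧ e.1 ≤ n)
    (h : Set.InjOn (fun e : ℕ × ℕ × Fin m => (e.1, e.2.2)) E) :
    (choiceMeasure m n).real (presentEvent n E) = edgeWeight E := by
  classical
  have hpi : presentEvent n E = Set.univ.pi fun s : Finset.Icc 2 n × Fin m =>
      {x : Finset.Ico 1 (s.1 : ℕ) | ∀ e ∈ E, e.1 = s.1 → e.2.2 = s.2 → (x : ℕ) = e.2.1} := by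
    ext ω
    rw [mem_presentEvent_iff hE]
    simp
  have hne : ∀ s : Finset.Icc 2 n × Fin m, Nonempty (Finset.Ico 1 (s.1 : ℕ)) := fun s =>
    nonempty_Ico s.1
  rw [measureReal_def, hpi, choiceMeasure, Measure.pi_pi, ENNReal.toReal_prod]
  set F : Finset.Icc 2 n × Fin m → ℝ := fun s =>
    (uniformOn (Set.univ : Set (Finset.Ico 1 (s.1 : ℕ)))).real
      {x | ∀ e ∈ E, e.1 = s.1 → e.2.2 = s.2 → (x : ℕ) = e.2.1} with hF
  change ∏ s, F s = _
  set σ : E → Finset.Icc 2 n × Fin m := fun e => (⟨e.1.1, Finset.mem_Icc.2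
    ⟨by have := hE e.1 e.2; omega, (hE e.1 e.2).2.2⟩⟩, e.1.2.2) with hσ
  have hσi : Function.Injective σ := by
    intro e f hef
    apply Subtype.ext
    apply h e.2 f.2
    simp only [hσ, Prod.mk.injEq, Subtype.mk.injEq] at hef ⊢
    exact hef
  have h1 : ∏ s, F s = ∏ s ∈ Finset.univ.image σ, F s := by
    refine (Finset.prod_subset (f := F) (Finset.subset_univ (Finset.univ.image σ))
      fun s _ hs => ?_).symm
    have : {x : Finset.Ico 1 (s.1 : ℕ) | ∀ e ∈ E, e.1 = s.1 → e.2.2 = s.2 → (x : ℕ) = e.2.1} =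
        Set.univ := by
      rw [Set.eq_univ_iff_forall]
      intro x e he h1 h2
      exfalso
      apply hs
      refine Finset.mem_image.2 ⟨⟨e, he⟩, Finset.mem_univ _, ?_⟩
      exact Prod.ext (Subtype.ext h1) h2
    simp only [hF]
    rw [this, probReal_univ]
  rw [h1, Finset.prod_image (f := F) hσi.injOn, edgeWeight, ← Finset.prod_coe_sort E]
  refine Finset.prod_congr rfl fun e _ => ?_
  obtain ⟨h1, h2, h3⟩ := hE e.1 e.2
  have hset : {x : Finset.Ico 1 ((σ e).1 : ℕ) | ∀ f ∈ E, f.1 = (σ e).1 → f.2.2 = (σ e).2 →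
      (x : ℕ) = f.2.1} = {⟨e.1.2.1, Finset.mem_Ico.2 ⟨h1, h2⟩⟩} := by
    ext x
    simp only [Set.mem_ofPred_eq, Set.mem_singleton_iff]
    constructor
    · intro hx
      exact Subtype.ext (hx e.1 e.2 rfl rfl)
    · rintro rfl f hf hf1 hf2
      have : f = e.1 := h hf e.2 (Prod.ext hf1 hf2)
      rw [this]
  simp only [hF]
  rw [hset]
  exact uniformOn_real_singleton _ (by change 2 ≤ e.1.1; omega) _

theorem edgeWeight_nonneg {m n : ℕ} {E : Finset (ℕ × ℕ × Fin m)}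
    (hE : ∀ e ∈ E, 1 ≤ e.2.1 ∧ e.2.1 < e.1 ∧ e.1 ≤ n) : 0 ≤ edgeWeight E := by
  refine Finset.prod_nonneg fun e he => ?_
  obtain ⟨h1, h2, -⟩ := hE e he
  have : (2 : ℝ) ≤ e.1 := by exact_mod_cast (show 2 ≤ e.1 by omega)
  exact div_nonneg zero_le_one (by linarith)

theorem presentEvent_real_le {m n : ℕ} {E : Finset (ℕ × ℕ × Fin m)}
    (hE : ∀ e ∈ E, 1 ≤ e.2.1 ∧ e.2.1 < e.1 ∧ e.1 ≤ n) :
    (choiceMeasure m n).real (presentEvent n E) ≤ edgeWeight E := by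
  by_cases h : Set.InjOn (fun e : ℕ × ℕ × Fin m => (e.1, e.2.2)) E
  · exact (presentEvent_real_eq hE h).le
  · rw [presentEvent_eq_empty h, measureReal_empty]
    exact edgeWeight_nonneg hE

theorem presentEvent_inter {m n : ℕ} [DecidableEq (ℕ × ℕ × Fin m)]
    (E F : Finset (ℕ × ℕ × Fin m)) :
    presentEvent n E ∩ presentEvent n F = presentEvent n (E ∪ F) := by
  ext ω
  simp only [presentEvent, Set.mem_inter_iff, Set.mem_ofPred_eq, Finset.mem_union]
  constructor
  · rintro ⟨h1, h2⟩ e (he | he)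
    · exact h1 e he
    · exact h2 e he
  · exact fun h => ⟨fun e he => h e (Or.inl he), fun e he => h e (Or.inr he)⟩

/-- Functions of disjoint sets of choices are uncorrelated. -/
theorem integral_mul_of_disjoint {m n : ℕ} (D₁ D₂ : Finset (Finset.Icc 2 n × Fin m))
    (hD : Disjoint D₁ D₂) (F₁ F₂ : Choices m n → ℝ)
    (h₁ : ∀ ω ω', (∀ s ∈ D₁, ω s = ω' s) → F₁ ω = F₁ ω')
    (h₂ : ∀ ω ω', (∀ s ∈ D₂, ω s = ω' s) → F₂ ω = F₂ ω') :
    ∫ ω, F₁ ω * F₂ ω ∂(choiceMeasure m n) =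
      (∫ ω, F₁ ω ∂(choiceMeasure m n)) * ∫ ω, F₂ ω ∂(choiceMeasure m n) := by
  classical
  have hne : ∀ s : Finset.Icc 2 n × Fin m, Nonempty (Finset.Ico 1 (s.1 : ℕ)) := fun s =>
    nonempty_Ico s.1
  have hind : iIndepFun (fun (s : Finset.Icc 2 n × Fin m) (ω : Choices m n) => ω s)
      (choiceMeasure m n) :=
    iIndepFun_pi (μ := fun s : Finset.Icc 2 n × Fin m =>
      uniformOn (Set.univ : Set (Finset.Ico 1 (s.1 : ℕ)))) (X := fun _ x => x)
      (fun _ => aemeasurable_id)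
  have hpair := hind.indepFun_finset D₁ D₂ hD (fun s => measurable_pi_apply s)
  -- Filling the other coordinates with arbitrary values exhibits each `F` as a function of the
  -- restricted choices.
  let extend : (D : Finset (Finset.Icc 2 n × Fin m)) →
      ((s : D) → Finset.Ico 1 (s.1.1 : ℕ)) → Choices m n := fun D x s =>
    if hs : s ∈ D then x ⟨s, hs⟩ else Classical.choice (hne s)
  have hcomp := hpair.comp (φ := fun x => F₁ (extend D₁ x)) (ψ := fun x => F₂ (extend D₂ x))
    Measurable.of_discrete Measurable.of_discrete
  have e₁ : ((fun x => F₁ (extend D₁ x)) ∘ fun (ω : Choices m n) (s : D₁) => ω s) = F₁ := by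
    funext ω
    exact h₁ _ _ fun s hs => by simp [extend, hs]
  have e₂ : ((fun x => F₂ (extend D₂ x)) ∘ fun (ω : Choices m n) (s : D₂) => ω s) = F₂ := by
    funext ω
    exact h₂ _ _ fun s hs => by simp [extend, hs]
  rw [e₁, e₂] at hcomp
  exact hcomp.integral_mul_eq_mul_integral (Measurable.of_discrete).aestronglyMeasurable
    (Measurable.of_discrete).aestronglyMeasurable

theorem integral_presentEvent_mul {m n : ℕ} (E : Finset (ℕ × ℕ × Fin m))
    (𝓕 : Finset (Finset (ℕ × ℕ × Fin m)))
    (hE : ∀ e ∈ E, 1 ≤ e.2.1 ∧ e.2.1 < e.1 ∧ e.1 ≤ n)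
    (h𝓕 : ∀ F ∈ 𝓕, (∀ e ∈ F, 1 ≤ e.2.1 ∧ e.2.1 < e.1 ∧ e.1 ≤ n) ∧ ¬ ShareChoice E F)
    (g : ℕ → ℝ) :
    ∫ ω, (((presentEvent n E).indicator (fun _ => 1) ω : ℕ) : ℝ) *
        g (∑ F ∈ 𝓕, (presentEvent n F).indicator (fun _ => 1) ω) ∂(choiceMeasure m n) =
      (choiceMeasure m n).real (presentEvent n E) *
        ∫ ω, g (∑ F ∈ 𝓕, (presentEvent n F).indicator (fun _ => 1) ω) ∂(choiceMeasure m n) := by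
  classical
  rw [← integral_indicator_one_natCast]
  set D : Finset (Finset.Icc 2 n × Fin m) :=
    Finset.univ.filter fun s => ∃ e ∈ E, e.1 = s.1 ∧ e.2.2 = s.2 with hD
  refine integral_mul_of_disjoint D Dᶜ disjoint_compl_right
    (fun ω => (((presentEvent n E).indicator (fun _ => 1) ω : ℕ) : ℝ))
    (fun ω => g (∑ F ∈ 𝓕, (presentEvent n F).indicator (fun _ => 1) ω)) ?_ ?_
  · intro ω ω' h
    have : ω ∈ presentEvent n E ↔ ω' ∈ presentEvent n E := by
      rw [mem_presentEvent_iff hE, mem_presentEvent_iff hE]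
      refine forall_congr' fun s => forall₄_congr fun e he h1 h2 => ?_
      rw [h s (by simp only [hD, Finset.mem_filter, Finset.mem_univ, true_and]
                  exact ⟨e, he, h1, h2⟩)]
    simp only [Set.indicator_apply, this]
  · intro ω ω' h
    have : ∀ F ∈ 𝓕, (ω ∈ presentEvent n F ↔ ω' ∈ presentEvent n F) := by
      intro F hF
      obtain ⟨hF1, hF2⟩ := h𝓕 F hF
      rw [mem_presentEvent_iff hF1, mem_presentEvent_iff hF1]
      refine forall_congr' fun s => forall₄_congr fun f hf h1 h2 => ?_
      rw [h s ?_]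
      simp only [hD, Finset.mem_compl, Finset.mem_filter, Finset.mem_univ, true_and]
      rintro ⟨e, he, h3, h4⟩
      exact hF2 ⟨e, he, f, hf, h3.trans h1.symm, h4.trans h2.symm⟩
    have : ∑ F ∈ 𝓕, (presentEvent n F).indicator (fun _ => 1) ω =
        ∑ F ∈ 𝓕, (presentEvent n F).indicator (fun _ => 1) ω' :=
      Finset.sum_congr rfl fun F hF => by simp only [Set.indicator_apply, this F hF]
    simp only [this]

end Probability

end UniformAttachment

namespace UniformAttachment

/-! ### Weighted sums over cycles that meet or overlap a given edge set. -/

section SecondMoment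

open Classical in
/-- The vertices of the edge set `E`. -/
noncomputable def vertexFinset {m : ℕ} (n : ℕ) (E : Finset (ℕ × ℕ × Fin m)) :
    Finset (Finset.Icc 1 n) :=
  Finset.univ.filter fun x => ∃ e ∈ E, (x : ℕ) = e.1 ∨ (x : ℕ) = e.2.1

theorem mem_vertexFinset {m n : ℕ} {E : Finset (ℕ × ℕ × Fin m)} {x : Finset.Icc 1 n} :
    x ∈ vertexFinset n E ↔ ∃ e ∈ E, (x : ℕ) = e.1 ∨ (x : ℕ) = e.2.1 := by
  simp [vertexFinset]

theorem card_vertexFinset_le {m n : ℕ} (E : Finset (ℕ × ℕ × Fin m)) :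
    (vertexFinset n E).card ≤ 2 * E.card := by
  classical
  rw [← Finset.card_image_of_injective _ Subtype.val_injective]
  calc _ ≤ (E.image (fun e => e.1) ∪ E.image fun e => e.2.1).card := by
        refine Finset.card_le_card fun y hy => ?_
        obtain ⟨x, hx, rfl⟩ := Finset.mem_image.1 hy
        obtain ⟨e, he, h | h⟩ := mem_vertexFinset.1 hx
        · exact Finset.mem_union_left _ (Finset.mem_image.2 ⟨e, he, h.symm⟩)
        · exact Finset.mem_union_right _ (Finset.mem_image.2 ⟨e, he, h.symm⟩)
    _ ≤ E.card + E.card :=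
        (Finset.card_union_le _ _).trans (add_le_add Finset.card_image_le Finset.card_image_le)
    _ = 2 * E.card := by ring

theorem cycleSets_valid {m r n : ℕ} (hr : 1 ≤ r) {E : Finset (ℕ × ℕ × Fin m)}
    (hE : E ∈ cycleSets m r n) : ∀ e ∈ E, 1 ≤ e.2.1 ∧ e.2.1 < e.1 ∧ e.1 ≤ n := by
  classical
  obtain ⟨v, a, hv, -, rfl⟩ := mem_cycleSets.1 hE
  intro e he
  obtain ⟨i, -, rfl⟩ := Finset.mem_image.1 he
  have h1 := Finset.mem_Icc.1 (v i).2
  have h2 := Finset.mem_Icc.1 (v (i + 1)).2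
  have h3 : (v i : ℕ) ≠ v (i + 1) := fun h => fin_ne_add_one hr i (hv (Subtype.ext h))
  simp only [walkEdge]
  omega

theorem card_of_mem_cycleSets {m r n : ℕ} {E : Finset (ℕ × ℕ × Fin m)}
    (hE : E ∈ cycleSets m r n) : E.card = r + 1 := by
  classical
  obtain ⟨v, a, -, he, rfl⟩ := mem_cycleSets.1 hE
  rw [Finset.card_image_of_injective _ he, Finset.card_univ, Fintype.card_fin]

theorem walkEdge_add {m r : ℕ} (v : Fin (r + 1) → ℕ) (a : Fin (r + 1) → Fin m)
    (k i : Fin (r + 1)) :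
    walkEdge (fun i => v (i + k)) (fun i => a (i + k)) i = walkEdge v a (i + k) := by
  simp only [walkEdge, add_right_comm]

theorem fin_val_nsmul_one {r : ℕ} (j : Fin (r + 1)) : j.val • (1 : Fin (r + 1)) = j := by
  have h : ∀ k : ℕ, k • (1 : Fin (r + 1)) = Fin.ofNat (r + 1) k := by
    intro k
    induction k with
    | zero => rw [zero_nsmul]; rfl
    | succ k ih =>
      rw [succ_nsmul, ih]
      apply Fin.ext
      simp [Fin.val_add, Fin.ofNat]
  rw [h]
  exact Fin.ext (Nat.mod_eq_of_lt j.2)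

/-- A cycle can be traversed starting from any of its vertices. -/
theorem exists_rotation {m r n : ℕ} {v : Fin (r + 1) → Finset.Icc 1 n} {a : Fin (r + 1) → Fin m}
    (hv : Function.Injective v) (he : Function.Injective (walkEdge (fun i => (v i : ℕ)) a))
    (k : Fin (r + 1)) :
    ∃ (v' : Fin (r + 1) → Finset.Icc 1 n) (a' : Fin (r + 1) → Fin m), Function.Injective v' ∧
      Function.Injective (walkEdge (fun i => (v' i : ℕ)) a') ∧
      Finset.univ.image (walkEdge (fun i => (v' i : ℕ)) a') =
        Finset.univ.image (walkEdge (fun i => (v i : ℕ)) a) ∧ v' 0 = v k ∧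
      walkEdge (fun i => (v' i : ℕ)) a' (Fin.last r) =
        walkEdge (fun i => (v i : ℕ)) a (Fin.last r + k) := by
  have hw : walkEdge (fun i => (v (i + k) : ℕ)) (fun i => a (i + k)) =
      walkEdge (fun i => (v i : ℕ)) a ∘ (· + k) :=
    funext fun i => walkEdge_add (fun i => (v i : ℕ)) a k i
  refine ⟨fun i => v (i + k), fun i => a (i + k), hv.comp (add_left_injective k), ?_, ?_, ?_, ?_⟩
  · rw [hw]
    exact he.comp (add_left_injective k)
  · rw [hw]
    ext e
    simp only [Finset.mem_image, Finset.mem_univ, true_and, Function.comp]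
    constructor
    · rintro ⟨i, rfl⟩
      exact ⟨i + k, rfl⟩
    · rintro ⟨i, rfl⟩
      exact ⟨i - k, by simp⟩
  · simp
  · rw [hw]; rfl

/-- Each `F` is coded by a closed walk from `A`. Steps along `E` stay in `A` and are free moves; the
others, including the last, are jumps, with `1 / (x - 1) ≤ 2 / x` for `x ≥ 2`. The labels account
for `m ^ (r + 1)`. -/
theorem sum_edgeWeight_sdiff_le {m r n L : ℕ} (hr : 1 ≤ r) [DecidableEq (ℕ × ℕ × Fin m)]
    (E : Finset (ℕ × ℕ × Fin m)) (A : Finset (Finset.Icc 1 n)) (hA : A.card ≤ L)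
    (hEA : vertexFinset n E ⊆ A) (𝓕 : Finset (Finset (ℕ × ℕ × Fin m)))
    (h𝓕 : ∀ F ∈ 𝓕, ∃ (v : Fin (r + 1) → Finset.Icc 1 n) (a : Fin (r + 1) → Fin m),
      Function.Injective v ∧ Function.Injective (walkEdge (fun i => (v i : ℕ)) a) ∧
      Finset.univ.image (walkEdge (fun i => (v i : ℕ)) a) = F ∧ v 0 ∈ A ∧
      walkEdge (fun i => (v i : ℕ)) a (Fin.last r) ∉ E) :
    ∑ F ∈ 𝓕, edgeWeight (F \ E) ≤
      m ^ (r + 1) * (2 * (9 + 2 * (L : ℝ) ^ 2 + L) ^ r * (1 + L) *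
        ∑ x ∈ A, 1 / ((x : ℕ) : ℝ)) := by
  classical
  rcases 𝓕.eq_empty_or_nonempty with rfl | ⟨F₀, hF₀⟩
  · rw [Finset.sum_empty]
    positivity
  obtain ⟨v₀, a₀, -⟩ := h𝓕 F₀ hF₀
  have : Nonempty (Fin m) := ⟨a₀ 0⟩
  have : Nonempty (Finset.Icc 1 n) := ⟨v₀ 0⟩
  set term : (Fin (r + 1) → Finset.Icc 1 n) → ℝ := fun w =>
    (if w 0 ∈ A then (1 : ℝ) else 0) *
      ((∏ i : Fin r, (2 / (max (w i.castSucc : ℕ) (w i.succ : ℕ) : ℝ) +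
        if w i.castSucc ∈ A ∧ w i.succ ∈ A then 1 else 0)) *
      (2 / (max (w (Fin.last r) : ℕ) (w 0 : ℕ) : ℝ))) with hterm
  have hK0 : ∀ (w : Fin (r + 1) → Finset.Icc 1 n) (i : Fin r),
      0 ≤ 2 / (max (w i.castSucc : ℕ) (w i.succ : ℕ) : ℝ) +
        if w i.castSucc ∈ A ∧ w i.succ ∈ A then 1 else 0 := fun w i => by
    refine add_nonneg (by positivity) ?_
    split_ifs <;> norm_num
  have hterm0 : ∀ w, 0 ≤ term w := fun w => by
    refine mul_nonneg ?_ (mul_nonneg (Finset.prod_nonneg fun i _ => hK0 w i) (by positivity))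
    split_ifs <;> norm_num
  choose! v a hv he hF hvA hlast using h𝓕
  have hinj : Set.InjOn (fun F => (v F, a F)) 𝓕 := by
    intro F hF1 G hG1 hFG
    simp only [Prod.mk.injEq] at hFG
    rw [← hF F hF1, ← hF G hG1, hFG.1, hFG.2]
  have hle : ∀ F ∈ 𝓕, edgeWeight (F \ E) ≤ term (v F) := by
    intro F hFm
    have hw : edgeWeight (F \ E) = ∏ i, if walkEdge (fun i => (v F i : ℕ)) (a F) i ∈ E then (1 : ℝ)
        else 1 / (((max (v F i : ℕ) (v F (i + 1) : ℕ) : ℕ) : ℝ) - 1) := by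
      have h1 : F \ E = F.filter fun e => ¬ e ∈ E := by ext; simp
      rw [edgeWeight, h1, Finset.prod_filter]
      nth_rw 1 [← hF F hFm]
      rw [Finset.prod_image fun i _ j _ hij => he F hFm hij]
      refine Finset.prod_congr rfl fun i _ => ?_
      rw [ite_not]
      rfl
    have hne : ∀ i, (v F i : ℕ) ≠ v F (i + 1) := fun i h =>
      fin_ne_add_one hr i (hv F hFm (Subtype.ext h))
    have hmax : ∀ i, (2 : ℝ) ≤ ((max (v F i : ℕ) (v F (i + 1) : ℕ) : ℕ) : ℝ) := by
      intro i
      have h1 := Finset.mem_Icc.1 (v F i).2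
      have h2 := Finset.mem_Icc.1 (v F (i + 1)).2
      have h3 := hne i
      exact_mod_cast (show 2 ≤ max (v F i : ℕ) (v F (i + 1) : ℕ) by omega)
    have hbd : ∀ x : ℝ, 2 ≤ x → 1 / (x - 1) ≤ 2 / x := by
      intro x hx
      rw [div_le_div_iff₀ (by linarith) (by linarith)]
      linarith
    have hbd0 : ∀ x : ℝ, 2 ≤ x → 0 ≤ 1 / (x - 1) := fun x hx =>
      div_nonneg zero_le_one (by linarith)
    rw [hw, Fin.prod_univ_castSucc, if_neg (hlast F hFm), hterm]
    simp only [if_pos (hvA F hFm), one_mul]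
    refine mul_le_mul (Finset.prod_le_prod (fun i _ => ?_) fun i _ => ?_) ?_ ?_ ?_
    · split_ifs
      · exact zero_le_one
      · exact hbd0 _ (hmax _)
    · split_ifs with h1 h2 h2
      · have : (0 : ℝ) ≤ 2 / (max (v F i.castSucc : ℕ) (v F i.succ : ℕ) : ℝ) := by positivity
        linarith
      · exfalso
        apply h2
        constructor
        · apply hEA
          rw [mem_vertexFinset]
          refine ⟨_, h1, ?_⟩
          simp only [walkEdge]
          omega
        · apply hEA
          rw [mem_vertexFinset]
          refine ⟨_, h1, ?_⟩
          simp only [walkEdge, Fin.coeSucc_eq_succ]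
          omega
      · have := hbd _ (hmax i.castSucc)
        rw [Fin.coeSucc_eq_succ] at this ⊢
        push_cast at this ⊢
        linarith
      · have := hbd _ (hmax i.castSucc)
        rw [Fin.coeSucc_eq_succ] at this ⊢
        push_cast at this ⊢
        linarith
    · have := hbd _ (hmax (Fin.last r))
      rw [Fin.last_add_one] at this ⊢
      push_cast at this ⊢
      exact this
    · exact hbd0 _ (hmax _)
    · exact Finset.prod_nonneg fun i _ => hK0 _ i
  calc ∑ F ∈ 𝓕, edgeWeight (F \ E) ≤ ∑ F ∈ 𝓕, term (v F) := Finset.sum_le_sum hle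
    _ = ∑ p ∈ 𝓕.image fun F => (v F, a F), term p.1 := by
        rw [Finset.sum_image hinj]
    _ ≤ ∑ p : (Fin (r + 1) → Finset.Icc 1 n) × (Fin (r + 1) → Fin m), term p.1 :=
        Finset.sum_le_sum_of_subset_of_nonneg (Finset.subset_univ _) fun p _ _ => hterm0 p.1
    _ = m ^ (r + 1) * ∑ w, term w := by
        rw [Fintype.sum_prod_type_right]
        simp
    _ ≤ _ := by
        gcongr
        exact sum_closed_walk_le n r L A hA

/-- The constant in the bounds for sums over cycles. -/
noncomputable def cycleConst (m r : ℕ) : ℝ :=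
  m ^ (r + 1) * (2 * (9 + 2 * ((2 * (r + 1) : ℕ) : ℝ) ^ 2 + (2 * (r + 1) : ℕ)) ^ r *
    (1 + (2 * (r + 1) : ℕ)))

theorem cycleConst_nonneg (m r : ℕ) : 0 ≤ cycleConst m r := by
  unfold cycleConst
  positivity

open Classical in
theorem sum_edgeWeight_meeting_le {m r n : ℕ} (hr : 1 ≤ r) (A : Finset (Finset.Icc 1 n))
    (hA : A.card ≤ 2 * (r + 1)) :
    ∑ F ∈ (cycleSets m r n).filter (fun F => ∃ x ∈ A, x ∈ vertexFinset n F), edgeWeight F ≤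
      cycleConst m r * ∑ x ∈ A, 1 / ((x : ℕ) : ℝ) := by
  have h := sum_edgeWeight_sdiff_le (m := m) hr ∅ A hA (by simp [vertexFinset])
    ((cycleSets m r n).filter (fun F => ∃ x ∈ A, x ∈ vertexFinset n F)) ?_
  · simp only [Finset.sdiff_empty] at h
    rw [cycleConst, mul_assoc]
    exact h
  · intro F hF
    obtain ⟨hFc, x, hxA, hxF⟩ := Finset.mem_filter.1 hF
    obtain ⟨v, a, hv, he, rfl⟩ := mem_cycleSets.1 hFc
    obtain ⟨e, hemem, hx⟩ := mem_vertexFinset.1 hxF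
    obtain ⟨i, -, rfl⟩ := Finset.mem_image.1 hemem
    have : ∃ k, v k = x := by
      simp only [walkEdge] at hx
      by_cases h : (x : ℕ) = v i
      · exact ⟨i, Subtype.ext h.symm⟩
      · exact ⟨i + 1, Subtype.ext (by omega)⟩
    obtain ⟨k, rfl⟩ := this
    obtain ⟨v', a', h1, h2, h3, h4, -⟩ := exists_rotation hv he k
    exact ⟨v', a', h1, h2, h3, h4 ▸ hxA, Finset.notMem_empty _⟩

-- The cycle `F` shares an edge with `E` but is not `E`, so somewhere along it an edge outside `E`
-- is followed by one in `E`. Starting the walk between these two puts its origin on `E` and makes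
-- its last step a jump.
open Classical in
theorem sum_edgeWeight_overlap_le {m r n : ℕ} (hr : 1 ≤ r) {E : Finset (ℕ × ℕ × Fin m)}
    (hE : E ∈ cycleSets m r n) :
    ∑ F ∈ (cycleSets m r n).filter (fun F => F ≠ E ∧ ∃ e ∈ E, e ∈ F), edgeWeight (F \ E) ≤
      cycleConst m r * ∑ x ∈ vertexFinset n E, 1 / ((x : ℕ) : ℝ) := by
  have h := sum_edgeWeight_sdiff_le (m := m) hr E (vertexFinset n E) (L := 2 * (r + 1))
    (by rw [← card_of_mem_cycleSets hE]; exact card_vertexFinset_le E) subset_rfl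
    ((cycleSets m r n).filter (fun F => F ≠ E ∧ ∃ e ∈ E, e ∈ F)) ?_
  · rw [cycleConst, mul_assoc]
    exact h
  · intro F hF
    obtain ⟨hFc, hne, f, hfE, hfF⟩ := Finset.mem_filter.1 hF
    obtain ⟨v, a, hv, he, hFeq⟩ := mem_cycleSets.1 hFc
    have hj : ∃ j, walkEdge (fun i => (v i : ℕ)) a j ∈ E ∧
        walkEdge (fun i => (v i : ℕ)) a (Fin.last r + j) ∉ E := by
      by_contra! hcon
      apply hne
      refine Finset.eq_of_subset_of_card_le ?_
        (by rw [card_of_mem_cycleSets hE, card_of_mem_cycleSets hFc])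
      rw [← hFeq] at hfF ⊢
      obtain ⟨i, -, rfl⟩ := Finset.mem_image.1 hfF
      -- Adding `Fin.last r = -1` steps back along the cycle, so if there were no such transition
      -- all of `F` would lie in `E`, and equal cardinalities would give `F = E`.
      have hall : ∀ k : ℕ, walkEdge (fun i => (v i : ℕ)) a (k • Fin.last r + i) ∈ E := by
        intro k
        induction k with
        | zero => simpa using hfE
        | succ k ih =>
          have := hcon _ ih
          rwa [← add_assoc, ← succ_nsmul'] at this
      intro e hemem
      obtain ⟨j, -, rfl⟩ := Finset.mem_image.1 hemem
      have h1 : Fin.last r = -1 := by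
        rw [eq_neg_iff_add_eq_zero, Fin.last_add_one]
      have h2 : j = (i - j).val • Fin.last r + i := by
        rw [h1, smul_neg, fin_val_nsmul_one]
        simp
      rw [h2]
      exact hall _
    obtain ⟨j, hj1, hj2⟩ := hj
    obtain ⟨v', a', h1, h2, h3, h4, h5⟩ := exists_rotation hv he j
    refine ⟨v', a', h1, h2, h3.trans hFeq, ?_, h5 ▸ hj2⟩
    rw [h4, mem_vertexFinset]
    refine ⟨_, hj1, ?_⟩
    simp only [walkEdge]
    omega

theorem sum_one_div_sq_le (n : ℕ) : ∑ x ∈ Finset.Icc 1 n, 1 / (x : ℝ) ^ 2 ≤ 2 := by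
  have : ∑ x ∈ Finset.Icc 1 n, 1 / (x : ℝ) ^ 2 ≤ 2 - 2 * (1 / ((n : ℝ) + 1)) := by
    induction n with
    | zero => simp
    | succ n ih =>
      rw [Finset.sum_Icc_succ_top (by omega)]
      have : 1 / ((n + 1 : ℕ) : ℝ) ^ 2 ≤ 2 * (1 / ((n : ℝ) + 1) - 1 / ((n : ℝ) + 1 + 1)) := by
        push_cast
        rw [div_sub_div _ _ (by positivity) (by positivity), mul_div_assoc',
          div_le_div_iff₀ (by positivity) (by positivity)]
        nlinarith [sq_nonneg (n : ℝ), (Nat.cast_nonneg n : (0 : ℝ) ≤ n)]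
      push_cast at *
      linarith
  have h2 : 0 ≤ 1 / ((n : ℝ) + 1) := by positivity
  linarith

-- Exchange the sums: the cycles through a single `x` weigh at most `cycleConst m r / x`. Used with
-- `F = 1` for the mean and `F x = 1 / x` for the dependent pairs.
open Classical in
theorem sum_edgeWeight_mul_le {m r n : ℕ} (hr : 1 ≤ r) (F : Finset.Icc 1 n → ℝ)
    (hF : ∀ x, 0 ≤ F x) :
    ∑ E ∈ cycleSets m r n, edgeWeight E * ∑ x ∈ vertexFinset n E, F x ≤
      cycleConst m r * ∑ x, F x * (1 / ((x : ℕ) : ℝ)) := by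
  calc ∑ E ∈ cycleSets m r n, edgeWeight E * ∑ x ∈ vertexFinset n E, F x
      = ∑ E ∈ cycleSets m r n, ∑ x, if x ∈ vertexFinset n E then F x * edgeWeight E else 0 := by
        refine Finset.sum_congr rfl fun E _ => ?_
        rw [← Finset.sum_filter, Finset.filter_mem_eq_inter, Finset.univ_inter, Finset.mul_sum]
        exact Finset.sum_congr rfl fun x _ => mul_comm _ _
    _ = ∑ x, F x * ∑ E ∈ (cycleSets m r n).filter (fun E => ∃ y ∈ ({x} : Finset (Finset.Icc 1 n)),
          y ∈ vertexFinset n E), edgeWeight E := by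
        rw [Finset.sum_comm]
        refine Finset.sum_congr rfl fun x _ => ?_
        rw [← Finset.sum_filter, Finset.mul_sum]
        simp
    _ ≤ ∑ x, F x * (cycleConst m r * (1 / ((x : ℕ) : ℝ))) := by
        refine Finset.sum_le_sum fun x _ => mul_le_mul_of_nonneg_left ?_ (hF x)
        have := sum_edgeWeight_meeting_le (m := m) hr {x} (by simp; omega)
        rwa [Finset.sum_singleton] at this
    _ = _ := by
        rw [Finset.mul_sum]
        exact Finset.sum_congr rfl fun x _ => by ring

end SecondMoment

end UniformAttachment

namespace UniformAttachment

/-! ### Logarithmic lower bound for the mean. -/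

section LowerBound

/-- The cycle that visits the vertices of `t` in increasing order and then returns. -/
theorem exists_monotone_cycle {m r n : ℕ} (hm : 2 ≤ m) (hr : 1 ≤ r) (t : Finset ℕ)
    (ht : t ⊆ Finset.Icc 1 n) (hcard : t.card = r + 1) (j : ℕ) (hj : ∀ x ∈ t, x ≤ j) :
    ∃ E ∈ cycleSets m r n, (vertexFinset n E).image Subtype.val = t ∧
      (1 / ((j : ℝ) - 1)) ^ (r + 1) ≤ (choiceMeasure m n).real (presentEvent n E) := by
  classical
  set v : Fin (r + 1) → Finset.Icc 1 n := fun i =>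
    ⟨t.orderEmbOfFin hcard i, ht (t.orderEmbOfFin_mem hcard i)⟩ with hv
  have hmono : StrictMono v := fun i k h => (t.orderEmbOfFin hcard).strictMono h
  have hvt : ∀ i, (v i : ℕ) ∈ t := fun i => t.orderEmbOfFin_mem hcard i
  -- The closing edge and the last ascending edge have the same upper endpoint; a second label,
  -- available as `m ≥ 2`, puts them in different slots.
  set a : Fin (r + 1) → Fin m := fun i =>
    if i = Fin.last r then ⟨1, by omega⟩ else ⟨0, by omega⟩ with ha
  set w := walkEdge (fun i => (v i : ℕ)) a with hw
  have hcast : ∀ i : Fin r, (w i.castSucc).1 = v i.succ ∧ (w i.castSucc).2.2 = ⟨0, by omega⟩ := by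
    intro i
    have h1 : (v i.castSucc : ℕ) ≤ v i.succ := hmono.monotone i.castSucc_lt_succ.le
    constructor
    · simp only [hw, walkEdge, Fin.coeSucc_eq_succ]
      exact max_eq_right h1
    · simp [hw, walkEdge, ha, Fin.castSucc_ne_last]
  have hlast : (w (Fin.last r)).2.2 = ⟨1, by omega⟩ := by
    simp [hw, walkEdge, ha]
  have hslot : Function.Injective fun i => ((w i).1, (w i).2.2) := by
    intro i k hik
    simp only [Prod.mk.injEq] at hik
    obtain ⟨h1, h2⟩ := hik
    induction i using Fin.lastCases with
    | last =>
      induction k using Fin.lastCases with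
      | last => rfl
      | cast k => rw [hlast, (hcast k).2] at h2; simp at h2
    | cast i =>
      induction k using Fin.lastCases with
      | last => rw [hlast, (hcast i).2] at h2; simp at h2
      | cast k =>
        rw [(hcast i).1, (hcast k).1] at h1
        rw [Fin.succ_injective _ (hmono.injective (Subtype.ext h1))]
  have hwi : Function.Injective w :=
    Function.Injective.of_comp (f := fun e : ℕ × ℕ × Fin m => (e.1, e.2.2)) hslot
  have hE : Finset.univ.image w ∈ cycleSets m r n :=
    mem_cycleSets.2 ⟨v, a, hmono.injective, hwi, rfl⟩
  refine ⟨Finset.univ.image w, hE, ?_, ?_⟩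
  · ext x
    rw [Finset.mem_image]
    constructor
    · rintro ⟨x, hx, rfl⟩
      obtain ⟨e, he, hxe⟩ := mem_vertexFinset.1 hx
      obtain ⟨i, -, rfl⟩ := Finset.mem_image.1 he
      have h1 := hvt i
      have h2 := hvt (i + 1)
      simp only [hw, walkEdge] at hxe
      have : (x : ℕ) = v i ∨ (x : ℕ) = v (i + 1) := by omega
      rcases this with h | h
      · rwa [h]
      · rwa [h]
    · intro hx
      have : x ∈ Set.range (t.orderEmbOfFin hcard) := by
        rw [Finset.range_orderEmbOfFin]; exact hx
      obtain ⟨i, rfl⟩ := this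
      refine ⟨v i, mem_vertexFinset.2 ⟨w i, Finset.mem_image_of_mem _ (Finset.mem_univ i), ?_⟩, rfl⟩
      simp only [hw, walkEdge]
      omega
  · have hval := cycleSets_valid hr hE
    rw [presentEvent_real_eq hval]
    · rw [edgeWeight, Finset.prod_image hwi.injOn]
      have hc : (1 / ((j : ℝ) - 1)) ^ (r + 1) = ∏ _i : Fin (r + 1), 1 / ((j : ℝ) - 1) := by simp
      rw [hc]
      have hb : ∀ i, 2 ≤ (w i).1 ∧ (w i).1 ≤ j := by
        intro i
        have h1 := hval (w i) (Finset.mem_image_of_mem _ (Finset.mem_univ i))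
        refine ⟨by omega, ?_⟩
        have h2 := hj _ (hvt i)
        have h3 := hj _ (hvt (i + 1))
        simp only [hw, walkEdge]
        omega
      refine Finset.prod_le_prod (fun i _ => ?_) fun i _ => ?_
      · have : (2 : ℝ) ≤ j := by exact_mod_cast (hb i).1.trans (hb i).2
        exact div_nonneg zero_le_one (by linarith)
      · have h1 : (2 : ℝ) ≤ (w i).1 := by exact_mod_cast (hb i).1
        have h2 : ((w i).1 : ℝ) ≤ j := by exact_mod_cast (hb i).2
        exact one_div_le_one_div_of_le (by linarith) (by linarith)
    · intro e he f hf hef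
      obtain ⟨i, -, rfl⟩ := Finset.mem_image.1 (Finset.mem_coe.1 he)
      obtain ⟨k, -, rfl⟩ := Finset.mem_image.1 (Finset.mem_coe.1 hf)
      rw [hslot hef]

/-- The cycles have top vertex `i + 2` and `r` further vertices in `[i + 1]`. Their vertex sets tell
them apart. -/
theorem sum_choose_le {m r N : ℕ} (hm : 2 ≤ m) (hr : 1 ≤ r) :
    ∑ i ∈ Finset.range N, ((i + 1).choose r : ℝ) * (1 / ((i : ℝ) + 1)) ^ (r + 1) ≤
      ∑ E ∈ cycleSets m r (N + 1), (choiceMeasure m (N + 1)).real (presentEvent (N + 1) E) := by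
  classical
  set P : Finset (Σ _ : ℕ, Finset ℕ) := (Finset.range N).sigma fun i =>
    Finset.powersetCard r (Finset.Icc 1 (i + 1)) with hP
  have hmem : ∀ p ∈ P, p.1 < N ∧ p.2 ⊆ Finset.Icc 1 (p.1 + 1) ∧ p.2.card = r := by
    intro p hp
    rw [hP, Finset.mem_sigma, Finset.mem_range, Finset.mem_powersetCard] at hp
    exact hp
  have hnot : ∀ p ∈ P, ∀ x ∈ p.2, x < p.1 + 2 := by
    intro p hp x hx
    have := Finset.mem_Icc.1 ((hmem p hp).2.1 hx)
    omega
  have hex : ∀ p ∈ P, ∃ E ∈ cycleSets m r (N + 1),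
      (vertexFinset (N + 1) E).image Subtype.val = insert (p.1 + 2) p.2 ∧
      (1 / (((p.1 + 2 : ℕ) : ℝ) - 1)) ^ (r + 1) ≤
        (choiceMeasure m (N + 1)).real (presentEvent (N + 1) E) := by
    intro p hp
    obtain ⟨h1, h2, h3⟩ := hmem p hp
    refine exists_monotone_cycle hm hr _ ?_ ?_ _ ?_
    · intro x hx
      rcases Finset.mem_insert.1 hx with rfl | hx
      · exact Finset.mem_Icc.2 ⟨by omega, by omega⟩
      · have := Finset.mem_Icc.1 (h2 hx)
        exact Finset.mem_Icc.2 ⟨by omega, by omega⟩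
    · rw [Finset.card_insert_of_notMem fun h => (hnot p hp _ h).false, h3]
    · intro x hx
      rcases Finset.mem_insert.1 hx with rfl | hx
      · exact le_rfl
      · exact (hnot p hp x hx).le
  choose! Φ hΦ hΦv hΦp using hex
  have hinj : Set.InjOn Φ P := by
    intro p hp q hq hpq
    have h := hΦv p hp
    rw [hpq, hΦv q hq] at h
    have h1 : p.1 = q.1 := by
      have hp1 : p.1 + 2 ∈ insert (q.1 + 2) q.2 := h ▸ Finset.mem_insert_self _ _
      have hq1 : q.1 + 2 ∈ insert (p.1 + 2) p.2 := h ▸ Finset.mem_insert_self _ _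
      rcases Finset.mem_insert.1 hp1 with h1 | h1
      · omega
      · rcases Finset.mem_insert.1 hq1 with h2 | h2
        · omega
        · have := hnot q hq _ h1
          have := hnot p hp _ h2
          omega
    have h2 : p.2 = q.2 := by
      rw [← Finset.erase_insert (fun h => (hnot p hp _ h).false), ← h, h1,
        Finset.erase_insert (fun h => (hnot q hq _ h).false)]
    exact Sigma.ext h1 (heq_of_eq h2)
  calc _ = ∑ p ∈ P, (1 / (((p.1 + 2 : ℕ) : ℝ) - 1)) ^ (r + 1) := by
        rw [hP, Finset.sum_sigma]
        refine Finset.sum_congr rfl fun i _ => ?_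
        dsimp only
        rw [Finset.sum_const, Finset.card_powersetCard, Nat.card_Icc, nsmul_eq_mul]
        congr 3
        push_cast
        ring
    _ ≤ ∑ p ∈ P, (choiceMeasure m (N + 1)).real (presentEvent (N + 1) (Φ p)) :=
        Finset.sum_le_sum hΦp
    _ = ∑ E ∈ P.image Φ, (choiceMeasure m (N + 1)).real (presentEvent (N + 1) E) := by
        rw [Finset.sum_image hinj]
    _ ≤ _ := by
        refine Finset.sum_le_sum_of_subset_of_nonneg ?_ fun _ _ _ => measureReal_nonneg
        intro E hE
        obtain ⟨p, hp, rfl⟩ := Finset.mem_image.1 hE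
        exact hΦ p hp

theorem le_choose_mul_pow (r k : ℕ) (hk : 1 ≤ k) (h : 2 * r ≤ k) :
    1 / (2 ^ r * (r.factorial : ℝ)) * (k : ℝ)⁻¹ ≤
      (k.choose r : ℝ) * (1 / (k : ℝ)) ^ (r + 1) := by
  have hk0 : (0 : ℝ) < k := by exact_mod_cast hk
  have h1 : ((k : ℝ) / 2) ^ r / r.factorial ≤ (k.choose r : ℝ) := by
    refine le_trans ?_ (Nat.pow_le_choose r k)
    gcongr
    rw [Nat.cast_sub (by omega), div_le_iff₀ two_pos]
    have : (2 : ℝ) * r ≤ k := by exact_mod_cast h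
    push_cast
    linarith
  calc 1 / (2 ^ r * (r.factorial : ℝ)) * (k : ℝ)⁻¹
      = ((k : ℝ) / 2) ^ r / r.factorial * (1 / (k : ℝ)) ^ (r + 1) := by
        have : (r.factorial : ℝ) ≠ 0 := by positivity
        rw [div_pow, one_div, one_div, inv_pow, pow_succ]
        field_simp
    _ ≤ _ := by gcongr

theorem log_le_sum_presentEvent {m r n : ℕ} (hm : 2 ≤ m) (hr : 1 ≤ r) (hn : 1 ≤ n) :
    1 / (2 ^ r * (r.factorial : ℝ)) * (Real.log n - 2 * r) ≤
      ∑ E ∈ cycleSets m r n, (choiceMeasure m n).real (presentEvent n E) := by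
  obtain ⟨N, rfl⟩ : ∃ N, n = N + 1 := ⟨n - 1, by omega⟩
  refine le_trans ?_ (sum_choose_le hm hr)
  set c : ℝ := 1 / (2 ^ r * (r.factorial : ℝ)) with hc
  have hc0 : 0 ≤ c := by positivity
  have hharm : Real.log ((N + 1 : ℕ) : ℝ) ≤ ∑ i ∈ Finset.range N, ((i : ℝ) + 1)⁻¹ := by
    refine (log_add_one_le_harmonic N).trans (le_of_eq ?_)
    simp [harmonic]
  -- The binomial estimate needs `2 * r ≤ i + 1`; each smaller index is discarded at a loss of at
  -- most `1`.
  have hsmall : ∑ i ∈ Finset.range N, (if i < 2 * r then (1 : ℝ) else 0) ≤ 2 * r := by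
    rw [← Finset.sum_filter, Finset.sum_const, nsmul_one]
    have : ((Finset.range N).filter fun i => i < 2 * r).card ≤ 2 * r := by
      calc _ ≤ (Finset.range (2 * r)).card := Finset.card_le_card fun i hi =>
            Finset.mem_range.2 (Finset.mem_filter.1 hi).2
        _ = 2 * r := Finset.card_range _
    exact_mod_cast this
  calc c * (Real.log ((N + 1 : ℕ) : ℝ) - 2 * r)
      ≤ c * (∑ i ∈ Finset.range N, ((i : ℝ) + 1)⁻¹ -
          ∑ i ∈ Finset.range N, (if i < 2 * r then (1 : ℝ) else 0)) := by gcongr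
    _ = ∑ i ∈ Finset.range N, c * (((i : ℝ) + 1)⁻¹ - if i < 2 * r then (1 : ℝ) else 0) := by
        rw [← Finset.sum_sub_distrib, Finset.mul_sum]
    _ ≤ _ := by
        refine Finset.sum_le_sum fun i _ => ?_
        split_ifs with h
        · have h1 : ((i : ℝ) + 1)⁻¹ ≤ 1 :=
            inv_le_one_of_one_le₀ (by linarith [(Nat.cast_nonneg i : (0 : ℝ) ≤ i)])
          have h2 : c * (((i : ℝ) + 1)⁻¹ - 1) ≤ 0 :=
            mul_nonpos_of_nonneg_of_nonpos hc0 (by linarith)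
          have h3 : (0 : ℝ) ≤ ((i + 1).choose r : ℝ) * (1 / ((i : ℝ) + 1)) ^ (r + 1) := by
            positivity
          linarith
        · have := le_choose_mul_pow r (i + 1) (by omega) (by omega)
          push_cast at this
          rw [sub_zero]
          exact this

end LowerBound

end UniformAttachment

namespace UniformAttachment

/-! ### Order of the mean, the dependency sum and the total variation bound. -/

section Main

theorem cycleMean_eq {m r n : ℕ} (hr : 1 ≤ r) :
    cycleMean m (r + 1) n =
      ∑ E ∈ cycleSets m r n, (choiceMeasure m n).real (presentEvent n E) := by
  rw [cycleMean]
  simp_rw [cycleCount_eq hr]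
  push_cast
  rw [integral_finsetSum _ fun _ _ => Integrable.of_finite]
  refine Finset.sum_congr rfl fun E _ => ?_
  rw [← integral_indicator_one_natCast]

theorem cycleMean_le {m r n : ℕ} (hr : 1 ≤ r) :
    cycleMean m (r + 1) n ≤ cycleConst m r * (1 + Real.log n) := by
  rw [cycleMean_eq hr]
  have h := sum_edgeWeight_mul_le (m := m) (n := n) hr (fun _ => 1) (fun _ => zero_le_one)
  calc _ ≤ ∑ E ∈ cycleSets m r n, edgeWeight E * ∑ x ∈ vertexFinset n E, (1 : ℝ) := by
        refine Finset.sum_le_sum fun E hE => ?_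
        have hv := cycleSets_valid hr hE
        refine (presentEvent_real_le hv).trans (le_mul_of_one_le_right (edgeWeight_nonneg hv) ?_)
        obtain ⟨e, he⟩ : E.Nonempty := by
          rw [← Finset.card_pos, card_of_mem_cycleSets hE]; omega
        have h1 := hv e he
        have : (⟨e.1, Finset.mem_Icc.2 ⟨by omega, h1.2.2⟩⟩ : Finset.Icc 1 n) ∈
            vertexFinset n E := mem_vertexFinset.2 ⟨e, he, Or.inl rfl⟩
        rw [Finset.sum_const, nsmul_one]
        exact_mod_cast Finset.card_pos.2 ⟨_, this⟩
    _ ≤ _ := h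
    _ ≤ _ := by
        refine mul_le_mul_of_nonneg_left ?_ (cycleConst_nonneg m r)
        simp only [one_mul]
        rw [Finset.sum_coe_sort (Finset.Icc 1 n) (fun x => 1 / (x : ℝ))]
        refine le_trans (le_of_eq ?_) (harmonic_le_one_add_log n)
        rw [harmonic_eq_sum_Icc]
        push_cast
        simp

open Classical in
theorem dependency_sum_le {m r n : ℕ} (hr : 1 ≤ r) :
    ∑ E ∈ cycleSets m r n,
      (∑ F ∈ (cycleSets m r n).filter (ShareChoice E),
        (choiceMeasure m n).real (presentEvent n E) * (choiceMeasure m n).real (presentEvent n F) +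
      ∑ F ∈ ((cycleSets m r n).filter (ShareChoice E)).erase E,
        (choiceMeasure m n).real (presentEvent n E ∩ presentEvent n F)) ≤
      4 * cycleConst m r ^ 2 := by
  set C := cycleConst m r
  have hC : 0 ≤ C := cycleConst_nonneg m r
  have hterm : ∀ E ∈ cycleSets m r n,
      (∑ F ∈ (cycleSets m r n).filter (ShareChoice E),
        (choiceMeasure m n).real (presentEvent n E) * (choiceMeasure m n).real (presentEvent n F) +
      ∑ F ∈ ((cycleSets m r n).filter (ShareChoice E)).erase E,
        (choiceMeasure m n).real (presentEvent n E ∩ presentEvent n F)) ≤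
      2 * C * (edgeWeight E * ∑ x ∈ vertexFinset n E, 1 / ((x : ℕ) : ℝ)) := by
    intro E hE
    have hEv := cycleSets_valid hr hE
    have hE0 := edgeWeight_nonneg hEv
    have hfirst : ∑ F ∈ (cycleSets m r n).filter (ShareChoice E),
        (choiceMeasure m n).real (presentEvent n E) *
          (choiceMeasure m n).real (presentEvent n F) ≤
        edgeWeight E * (C * ∑ x ∈ vertexFinset n E, 1 / ((x : ℕ) : ℝ)) := by
      rw [← Finset.mul_sum]
      refine mul_le_mul (presentEvent_real_le hEv) ?_
        (Finset.sum_nonneg fun _ _ => measureReal_nonneg) hE0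
      refine le_trans ?_ (sum_edgeWeight_meeting_le (m := m) hr (vertexFinset n E)
        (by rw [← card_of_mem_cycleSets hE]; exact card_vertexFinset_le E))
      calc _ ≤ ∑ F ∈ (cycleSets m r n).filter (ShareChoice E), edgeWeight F :=
            Finset.sum_le_sum fun F hF =>
              presentEvent_real_le (cycleSets_valid hr (Finset.mem_filter.1 hF).1)
        _ ≤ _ := by
            refine Finset.sum_le_sum_of_subset_of_nonneg (fun F hF => ?_) fun F hF _ =>
              edgeWeight_nonneg (cycleSets_valid hr (Finset.mem_filter.1 hF).1)
            obtain ⟨hFc, e, he, f, hf, hef, -⟩ := Finset.mem_filter.1 hF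
            have h1 := hEv e he
            refine Finset.mem_filter.2 ⟨hFc, ⟨e.1, Finset.mem_Icc.2 ⟨by omega, h1.2.2⟩⟩, ?_, ?_⟩
            · exact mem_vertexFinset.2 ⟨e, he, Or.inl rfl⟩
            · exact mem_vertexFinset.2 ⟨f, hf, Or.inl hef⟩
    have hsecond : ∑ F ∈ ((cycleSets m r n).filter (ShareChoice E)).erase E,
        (choiceMeasure m n).real (presentEvent n E ∩ presentEvent n F) ≤
        edgeWeight E * (C * ∑ x ∈ vertexFinset n E, 1 / ((x : ℕ) : ℝ)) := by
      calc _ ≤ ∑ F ∈ (cycleSets m r n).filter (fun F => F ≠ E ∧ ∃ e ∈ E, e ∈ F),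
            (choiceMeasure m n).real (presentEvent n E ∩ presentEvent n F) := by
            rw [← Finset.sum_filter_add_sum_filter_not
              (((cycleSets m r n).filter (ShareChoice E)).erase E) (fun F => ∃ e ∈ E, e ∈ F)]
            -- Cycles that share a slot but no edge demand different endpoints from one choice, so
            -- they never occur together.
            have hz : ∑ F ∈ (((cycleSets m r n).filter (ShareChoice E)).erase E).filter
                (fun F => ¬ ∃ e ∈ E, e ∈ F),
                (choiceMeasure m n).real (presentEvent n E ∩ presentEvent n F) = 0 := by
              refine Finset.sum_eq_zero fun F hF => ?_
              obtain ⟨hF1, hF2⟩ := Finset.mem_filter.1 hF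
              obtain ⟨-, e, he, f, hf, hef1, hef2⟩ :=
                Finset.mem_filter.1 (Finset.mem_of_mem_erase hF1)
              rw [presentEvent_inter, presentEvent_eq_empty, measureReal_empty]
              intro hinj
              have : e = f := hinj (Finset.mem_coe.2 (Finset.mem_union_left _ he))
                (Finset.mem_coe.2 (Finset.mem_union_right _ hf)) (Prod.ext hef1 hef2)
              exact hF2 ⟨e, he, this ▸ hf⟩
            rw [hz, add_zero]
            refine Finset.sum_le_sum_of_subset_of_nonneg (fun F hF => ?_) fun _ _ _ =>
              measureReal_nonneg
            obtain ⟨hF1, hF2⟩ := Finset.mem_filter.1 hF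
            obtain ⟨hne, hF3⟩ := Finset.mem_erase.1 hF1
            exact Finset.mem_filter.2 ⟨(Finset.mem_filter.1 hF3).1, hne, hF2⟩
        _ ≤ ∑ F ∈ (cycleSets m r n).filter (fun F => F ≠ E ∧ ∃ e ∈ E, e ∈ F),
            edgeWeight E * edgeWeight (F \ E) := by
            refine Finset.sum_le_sum fun F hF => ?_
            have hFv := cycleSets_valid hr (Finset.mem_filter.1 hF).1
            rw [presentEvent_inter, ← Finset.union_sdiff_self_eq_union]
            refine (presentEvent_real_le ?_).trans (le_of_eq ?_)
            · intro e he
              rcases Finset.mem_union.1 he with h | h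
              · exact hEv e h
              · exact hFv e (Finset.mem_sdiff.1 h).1
            · exact Finset.prod_union Finset.disjoint_sdiff
        _ ≤ _ := by
            rw [← Finset.mul_sum]
            exact mul_le_mul_of_nonneg_left (sum_edgeWeight_overlap_le hr hE) hE0
    linarith
  calc _ ≤ ∑ E ∈ cycleSets m r n,
        2 * C * (edgeWeight E * ∑ x ∈ vertexFinset n E, 1 / ((x : ℕ) : ℝ)) :=
        Finset.sum_le_sum hterm
    _ ≤ 2 * C * (C * 2) := by
        rw [← Finset.mul_sum]
        refine mul_le_mul_of_nonneg_left ?_ (by positivity)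
        refine (sum_edgeWeight_mul_le hr _ fun x => by positivity).trans
          (mul_le_mul_of_nonneg_left ?_ hC)
        rw [Finset.sum_coe_sort (Finset.Icc 1 n) (fun x => 1 / (x : ℝ) * (1 / (x : ℝ)))]
        refine le_trans (le_of_eq ?_) (sum_one_div_sq_le n)
        exact Finset.sum_congr rfl fun x _ => by ring
    _ = _ := by ring

theorem tvDist_le_one (ν₁ ν₂ : Measure ℕ) [IsProbabilityMeasure ν₁] [IsProbabilityMeasure ν₂] :
    tvDist ν₁ ν₂ ≤ 1 := by
  refine ciSup_le fun A => ?_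
  rw [abs_le]
  have h1 : 0 ≤ ν₁.real A := measureReal_nonneg
  have h2 : 0 ≤ ν₂.real A := measureReal_nonneg
  have h3 : ν₁.real A ≤ 1 := measureReal_le_one
  have h4 : ν₂.real A ≤ 1 := measureReal_le_one
  constructor <;> linarith

theorem tvDist_poisson_le_one (ν : Measure ℕ) [IsProbabilityMeasure ν] (r : NNReal) :
    tvDist ν (poissonMeasure r) ≤ 1 :=
  tvDist_le_one _ _

theorem isProbabilityMeasure_cycleLaw (m ℓ n : ℕ) : IsProbabilityMeasure (cycleLaw m ℓ n) :=
  Measure.isProbabilityMeasure_map (measurable_cycleCount m ℓ n).aemeasurable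

theorem tvDist_cycleLaw_poisson_le {m r n : ℕ} (hr : 1 ≤ r) (hpos : 0 < cycleMean m (r + 1) n) :
    tvDist (cycleLaw m (r + 1) n) (poissonMeasure ⟨cycleMean m (r + 1) n,
      cycleMean_nonneg m (r + 1) n⟩) ≤ 4 * cycleConst m r ^ 2 / cycleMean m (r + 1) n := by
  classical
  refine ciSup_le fun A => ?_
  have h := abs_real_sub_poisson_real_le (choiceMeasure m n) (cycleSets m r n) (presentEvent n)
    (fun E => (cycleSets m r n).filter (ShareChoice E)) ?_ (fun E _ => Finset.filter_subset _ _) ?_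
    ⟨cycleMean m (r + 1) n, cycleMean_nonneg m (r + 1) n⟩ hpos (cycleMean_eq hr) A
  · have hlaw : (cycleLaw m (r + 1) n).real A = (choiceMeasure m n).real
        {ω | ∑ E ∈ cycleSets m r n, (presentEvent n E).indicator (fun _ => 1) ω ∈ A} := by
      rw [cycleLaw, map_measureReal_apply (measurable_cycleCount _ _ _) MeasurableSet.of_discrete]
      congr 1
      ext ω
      simp only [Set.mem_preimage, Set.mem_ofPred_eq, cycleCount_eq hr]
    rw [hlaw]
    refine h.trans ?_
    change 1 / cycleMean m (r + 1) n * _ ≤ _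
    rw [one_div_mul_eq_div]
    exact div_le_div_of_nonneg_right (dependency_sum_le hr) hpos.le
  · intro E hE
    obtain ⟨e, he⟩ : E.Nonempty := by
      rw [← Finset.card_pos, card_of_mem_cycleSets hE]; omega
    exact Finset.mem_filter.2 ⟨hE, e, he, e, he, rfl, rfl⟩
  · intro E hE g
    refine integral_presentEvent_mul E _ (cycleSets_valid hr hE) (fun F hF => ?_) g
    obtain ⟨hFc, hF⟩ := Finset.mem_sdiff.1 hF
    exact ⟨cycleSets_valid hr hFc, fun hs => hF (Finset.mem_filter.2 ⟨hFc, hs⟩)⟩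

theorem exists_log_le_cycleMean {m r : ℕ} (hm : 2 ≤ m) (hr : 1 ≤ r) :
    ∃ c : ℝ, 0 < c ∧ ∀ᶠ n : ℕ in atTop, c * Real.log n ≤ cycleMean m (r + 1) n := by
  -- Half the constant suffices once `log n ≥ 4 * r`, since then `log n - 2 * r ≥ log n / 2`.
  refine ⟨1 / (2 ^ r * (r.factorial : ℝ)) / 2, by positivity, ?_⟩
  have hlog : Tendsto (fun n : ℕ => Real.log n) atTop atTop :=
    Real.tendsto_log_atTop.comp tendsto_natCast_atTop_atTop
  filter_upwards [hlog.eventually_ge_atTop (4 * r), eventually_ge_atTop 1] with n h1 h2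
  rw [cycleMean_eq hr]
  refine le_trans ?_ (log_le_sum_presentEvent hm hr h2)
  rw [div_mul_eq_mul_div, mul_div_assoc]
  refine mul_le_mul_of_nonneg_left ?_ (by positivity)
  linarith

end Main

end UniformAttachment

theorem theorem3p1 (m ℓ : ℕ) (hm : 2 ≤ m) (hℓ : 2 ≤ ℓ) :
    (fun n : ℕ => UniformAttachment.cycleMean m ℓ n) =Θ[atTop] (fun n : ℕ => Real.log n) ∧
    ∃ C : ℝ, 0 < C ∧ ∀ n : ℕ, 2 ≤ n →
      UniformAttachment.tvDist (UniformAttachment.cycleLaw m ℓ n)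
        (poissonMeasure ⟨UniformAttachment.cycleMean m ℓ n,
          UniformAttachment.cycleMean_nonneg m ℓ n⟩) ≤ C / Real.log n := by
  obtain ⟨r, rfl⟩ : ∃ r, ℓ = r + 1 := ⟨ℓ - 1, by omega⟩
  have hr : 1 ≤ r := by omega
  obtain ⟨c, hc, hlow⟩ := UniformAttachment.exists_log_le_cycleMean hm hr
  have hlogpos : ∀ n : ℕ, 2 ≤ n → 0 < Real.log n := fun n hn =>
    Real.log_pos (by exact_mod_cast (show 1 < n by omega))
  refine ⟨⟨?_, ?_⟩, ?_⟩
  · have hlog : Tendsto (fun n : ℕ => Real.log n) atTop atTop :=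
      Real.tendsto_log_atTop.comp tendsto_natCast_atTop_atTop
    refine IsBigO.of_bound (2 * UniformAttachment.cycleConst m r) ?_
    filter_upwards [hlog.eventually_ge_atTop 1] with n hn
    rw [Real.norm_of_nonneg (UniformAttachment.cycleMean_nonneg _ _ _),
      Real.norm_of_nonneg (by linarith)]
    refine (UniformAttachment.cycleMean_le hr).trans ?_
    have := UniformAttachment.cycleConst_nonneg m r
    nlinarith
  · refine IsBigO.of_bound c⁻¹ ?_
    filter_upwards [hlow, eventually_ge_atTop 2] with n hn h2
    rw [Real.norm_of_nonneg (UniformAttachment.cycleMean_nonneg _ _ _),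
      Real.norm_of_nonneg (hlogpos n h2).le, inv_mul_eq_div, le_div_iff₀ hc, mul_comm]
    exact hn
  · obtain ⟨N, hN⟩ := eventually_atTop.1 hlow
    set B := 4 * UniformAttachment.cycleConst m r ^ 2 with hB
    have hB0 : 0 ≤ B := by positivity
    have hlogN : 0 ≤ Real.log (N + 1 : ℕ) := Real.log_natCast_nonneg _
    -- The first summand serves `n ≥ N`; the second makes the bound at least `1` for `n < N`, where
    -- the mean may even vanish; the third ensures positivity.
    refine ⟨B / c + Real.log (N + 1 : ℕ) + 1, by positivity, fun n hn => ?_⟩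
    have hl := hlogpos n hn
    have hBc : 0 ≤ B / c := by positivity
    rcases le_or_gt N n with h | h
    · have hmean := hN n h
      have hpos : 0 < UniformAttachment.cycleMean m (r + 1) n :=
        (mul_pos hc hl).trans_le hmean
      refine (UniformAttachment.tvDist_cycleLaw_poisson_le hr hpos).trans ?_
      calc B / UniformAttachment.cycleMean m (r + 1) n ≤ B / (c * Real.log n) := by gcongr
        _ = B / c / Real.log n := by rw [div_div]
        _ ≤ _ := by
          gcongr
          linarith
    · have := UniformAttachment.isProbabilityMeasure_cycleLaw m (r + 1) n
      refine (UniformAttachment.tvDist_poisson_le_one _ _).trans ?_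
      rw [one_le_div hl]
      have : Real.log n ≤ Real.log (N + 1 : ℕ) :=
        Real.log_le_log (by positivity) (by exact_mod_cast (by omega))
      linarith
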